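/- Let $l\ge 1$ and let $P_0,\dots,P_m$ be a symmetric Clifford system on $\mathbb R^{2l}$, i.e. symmetric real $2l\times 2l$ matrices with $P_\alpha P_\beta+P_\beta P_\alpha=2\delta_{\alpha\beta}I_{2l}$. Put $$M_i=\{x\in S^{2l-1}(1): \langle P_0x,x\rangle=\dots=\langle P_ix,x\rangle=0\}\ (0\le i\le m),\qquad N_i=\{x\in S^{2l-1}(1): \textstyle\sum_{\alpha=0}^i\langle P_\alpha x,x\rangle^2=1\}\ (1\le i\le m).$$ These are embedded smooth submanifolds of $\mathbb R^{2l}$, of dimension $2l-i-2$ (if nonempty) and $l+i-1$ respectively, and carry the induced Riemannian metrics. A non-constant smooth function $f$ on a connected complete Riemannian manifold $N$ is called isoparametric if $|\nabla f|^2=b(f)$ and $\Delta f=a(f)$ for a smooth $b:\mathbb R\to\mathbb R$ and some $a:\mathbb R\to\mathbb R$; its nonempty regular level sets are called isoparametric hypersurfaces of $N$. The multiplicity of a principal curvature is the dimension of its eigenspace (multiplicity $0$ means that the value does not occur). (1) Let $0\le i\le m-1$ and $i+2\le l$. The function $f_i:M_i\to\mathbb R$, $f_i(x)=\langle P_{i+1}x,x\rangle$,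 has image $[-1,1]$, is isoparametric, and satisfies $|\nabla f_i|^2=4(1-f_i^2)$ and $\Delta f_i=-4(l-i-1)f_i$. For $c\in(-1,1)$, the level set $\mathcal U_c=f_i^{-1}(c)$ is a $(2l-i-3)$-dimensional submanifold, whose principal curvatures in $M_i$ at every point, with respect to the unit normal $\nabla f_i/|\nabla f_i|$, are $-\sqrt{\tfrac{1-c}{1+c}}$, $0$, $\sqrt{\tfrac{1+c}{1-c}}$ with multiplicities $l-i-2$, $i+1$, $l-i-2$, and there are no others; in particular there are exactly three distinct ones if $l-i-2>0$. For $c=\pm1$, the focal submanifolds $\mathcal U_{\pm1}=f_i^{-1}(\pm1)$ are submanifolds of dimension $l-1$, isometric to the round sphere $S^{l-1}(1)$ and totally geodesic in $M_i$. Moreover $M_{i+1}\subset M_i$ is a minimal isoparametric hypersurface of $M_i$. Finally, for all $i,j\ge 0$ with $i+j\le m$ (without assuming $i+2\le l$), $M_{i+j}$ is a (possibly empty) minimal submanifold of $M_i$. (2) Let $2\le i\le m$. The function $g_i:N_i\to\mathbb R$, $g_i(x)=\langle P_ix,x\rangle$, has image $[-1,1]$, is isoparametric, and satisfies $|\nabla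 g_i|^2=4(1-g_i^2)$ and $\Delta g_i=-4i\,g_i$. For $c\in(-1,1)$, the level set $\mathcal V_c=g_i^{-1}(c)$ is an $(l+i-2)$-dimensional submanifold, whose principal curvatures in $N_i$ at every point, with respect to the unit normal $\nabla g_i/|\nabla g_i|$, are $-\sqrt{\tfrac{1-c}{1+c}}$, $0$, $\sqrt{\tfrac{1+c}{1-c}}$ with multiplicities $i-1$, $l-i$, $i-1$, and there are no others; in particular there are exactly three distinct ones if $l>i$. For $c=\pm1$, the focal submanifolds $\mathcal V_{\pm1}=g_i^{-1}(\pm1)$ are submanifolds of dimension $l-1$, isometric to the round sphere $S^{l-1}(1)$ and totally geodesic in $N_i$. Moreover $N_{i-1}\subset N_i$ is a minimal isoparametric hypersurface of $N_i$. Finally, for all $i\ge 1$, $j\ge0$ with $i+j\le m$, $N_i$ is a minimal submanifold of $N_{i+j}$. -/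

import Mathlib

open scoped ContDiff

noncomputable section

/-! ## Submanifolds of a Euclidean space, with the induced Riemannian metric -/

section Submanifolds

variable {V W : Type*} [NormedAddCommGroup V] [InnerProductSpace ℝ V] [FiniteDimensional ℝ V]
  [NormedAddCommGroup W] [InnerProductSpace ℝ W] [FiniteDimensional ℝ W]

/-- `M` is an embedded smooth `d`-dimensional submanifold (without boundary) of `V`: near each of
its points it is the zero set of a smooth submersion onto some `ℝᵏ`, where `k + d = dim V`. -/
def IsEmbeddedSubmanifold (M : Set V) (d : ℕ) : Prop :=
  ∀ x ∈ M, ∃ (k : ℕ) (U : Set V) (ψ : V → EuclideanSpace ℝ (Fin k)),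
    k + d = Module.finrank ℝ V ∧ IsOpen U ∧ x ∈ U ∧ ContDiffOn ℝ ∞ ψ U ∧
      (∀ y ∈ U, Function.Surjective (fderiv ℝ ψ y)) ∧ M ∩ U = {y ∈ U | ψ y = 0}

/-- The tangent space `T_x M ⊆ V`. For a submanifold the tangent cone is already a linear subspace.
The derivative `fderivWithin ℝ F M x v` of a map `F` that is differentiable on `M` is
uniquely determined for `v ∈ T_x M`: it is the differential `dF_x(v)`. -/
def tangentSubspace (M : Set V) (x : V) : Submodule ℝ V :=
  Submodule.span ℝ (tangentConeAt ℝ M x)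

/-- The Riemannian gradient at `x` of a function `f` on the submanifold `M`: the vector of `T_x M`
that represents `df_x` on `T_x M`. -/
def submanifoldGradient (M : Set V) (f : V → ℝ) (x : V) : V :=
  (tangentSubspace M x).starProjection
    ((InnerProductSpace.toDual ℝ V).symm (fderivWithin ℝ f M x))

/-- The endomorphism `v ↦ ∇_v Y = (D_v Y)^⊤` of `T_x M`, where `∇` is the Levi-Civita connection of
the submanifold `M` and `Y` is a vector field on `M`. -/
def covariantDifferential (M : Set V) (Y : V → V) (x : V) :
    tangentSubspace M x →ₗ[ℝ] tangentSubspace M x :=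
  ((tangentSubspace M x).orthogonalProjectionOnto ∘L fderivWithin ℝ Y M x ∘L
    (tangentSubspace M x).subtypeL : tangentSubspace M x →L[ℝ] tangentSubspace M x)

/-- The Laplace-Beltrami operator `Δ f = div ∇f = tr (v ↦ ∇_v ∇f)` of the submanifold `M`. -/
def submanifoldLaplacian (M : Set V) (f : V → ℝ) (x : V) : ℝ :=
  LinearMap.trace ℝ (tangentSubspace M x)
    (covariantDifferential M (submanifoldGradient M f) x)

/-- The second fundamental form `B(X, Y) = ∇^M_X Y - ∇^S_X Y` at `x` of a submanifold `S` of the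
submanifold `M`. The vector `Y ∈ T_x S` is extended to the tangent vector field
`y ↦` (orthogonal projection of `Y` to `T_y S`) along `S`. -/
def secondFundamentalForm (S M : Set V) (x X Y : V) : V :=
  let D : V := fderivWithin ℝ (fun y => (tangentSubspace S y).starProjection Y) S x X
  (tangentSubspace M x).starProjection D - (tangentSubspace S x).starProjection D

/-- The mean curvature vector (trace of the second fundamental form) at `x` of `S` in `M`. -/
def meanCurvatureVector (S M : Set V) (x : V) : V :=
  ∑ a, secondFundamentalForm S M x
    (stdOrthonormalBasis ℝ (tangentSubspace S x) a : V)
    (stdOrthonormalBasis ℝ (tangentSubspace S x) a : V)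

/-- `S` is a minimal submanifold of `M`. -/
structure IsMinimalSubmanifold (S M : Set V) : Prop where
  ambient : ∃ d, IsEmbeddedSubmanifold M d
  submanifold : ∃ d, IsEmbeddedSubmanifold S d
  subset : S ⊆ M
  meanCurvature : ∀ x ∈ S, meanCurvatureVector S M x = 0

/-- `S` is a totally geodesic submanifold of `M`. -/
structure IsTotallyGeodesicSubmanifold (S M : Set V) : Prop where
  ambient : ∃ d, IsEmbeddedSubmanifold M d
  submanifold : ∃ d, IsEmbeddedSubmanifold S d
  subset : S ⊆ M
  secondFundamental : ∀ x ∈ S, ∀ X ∈ tangentSubspace S x, ∀ Y ∈ tangentSubspace S x,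
    secondFundamentalForm S M x X Y = 0

/-- The submanifolds `A` and `B` are isometric as Riemannian manifolds: there is a diffeomorphism
`F : A → B` (with inverse `G`) all of whose differentials preserve lengths of tangent vectors. -/
def AreRiemannianIsometric (A : Set V) (B : Set W) : Prop :=
  ∃ (F : V → W) (G : W → V), ContDiffOn ℝ ∞ F A ∧ ContDiffOn ℝ ∞ G B ∧
    Set.MapsTo F A B ∧ Set.MapsTo G B A ∧ Set.InvOn G F A B ∧
    ∀ x ∈ A, ∀ v ∈ tangentSubspace A x, ‖fderivWithin ℝ F A x v‖ = ‖v‖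

/-- The set `f⁻¹(c)` for a function `f` on `M`. -/
def levelSet (M : Set V) (f : V → ℝ) (c : ℝ) : Set V := {x ∈ M | f x = c}

/-- `f` is an isoparametric function on the connected complete Riemannian manifold `M`. (As a
complete subset of `V`, the manifold `M` is closed in `V`, so it is also complete as a Riemannian
manifold.) -/
structure IsIsoparametricFunction (M : Set V) (f : V → ℝ) : Prop where
  submanifold : ∃ d, IsEmbeddedSubmanifold M d
  connected : IsConnected M
  complete : IsComplete M
  smooth : ContDiffOn ℝ ∞ f M
  nonconstant : ∃ x ∈ M, ∃ y ∈ M, f x ≠ f y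
  transnormal : ∃ b : ℝ → ℝ, ContDiff ℝ ∞ b ∧
    ∀ x ∈ M, ‖submanifoldGradient M f x‖ ^ 2 = b (f x)
  laplacian : ∃ a : ℝ → ℝ, ∀ x ∈ M, submanifoldLaplacian M f x = a (f x)

/-- `S` is an isoparametric hypersurface of `M`: a (nonempty) regular level set of an isoparametric
function on `M`. -/
def IsIsoparametricHypersurface (S M : Set V) : Prop :=
  ∃ (f : V → ℝ) (c : ℝ), IsIsoparametricFunction M f ∧ S = levelSet M f c ∧ S.Nonempty ∧
    ∀ x ∈ S, submanifoldGradient M f x ≠ 0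

/-- The vector field `∇f / |∇f|`, a unit normal field of the regular level sets of `f` in `M`. -/
def levelUnitNormal (M : Set V) (f : V → ℝ) (x : V) : V :=
  ‖submanifoldGradient M f x‖⁻¹ • submanifoldGradient M f x

/-- The shape operator `A_ξ X = -(D_X ξ)^⊤` on `T_x S`, for a normal field `ξ` along `S`. Its
eigenvalues are the principal curvatures of `S` with respect to `ξ`; the multiplicity of a principal
curvature is the dimension of the eigenspace. -/
def shapeOperator (S : Set V) (ξ : V → V) (x : V) : Module.End ℝ (tangentSubspace S x) :=
  -covariantDifferential S ξ x

/-- Multiplicity of `κ` as a principal curvature at `x` of `S` with respect to `ξ`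
(zero if `κ` is not a principal curvature). -/
def principalMultiplicity (S : Set V) (ξ : V → V) (x : V) (κ : ℝ) : ℕ :=
  Module.finrank ℝ (Module.End.eigenspace (shapeOperator S ξ x) κ)

end Submanifolds

/-! ## Symmetric Clifford systems -/

section Clifford

variable {l m : ℕ}

/-- `P₀, …, P_m` is a symmetric Clifford system on `ℝ^{2l}`. -/
def IsSymmetricCliffordSystem (P : Fin (m + 1) → Matrix (Fin (2 * l)) (Fin (2 * l)) ℝ) : Prop :=
  (∀ α, (P α).IsSymm) ∧
    ∀ α β, P α * P β + P β * P α =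
      (if α = β then (2 : ℝ) else 0) • (1 : Matrix (Fin (2 * l)) (Fin (2 * l)) ℝ)

/-- The quadratic form `x ↦ ⟨A x, x⟩` on `ℝ^{2l}`. -/
def cliffordForm (A : Matrix (Fin (2 * l)) (Fin (2 * l)) ℝ)
    (x : EuclideanSpace ℝ (Fin (2 * l))) : ℝ :=
  inner ℝ (A.toEuclideanLin x) x

/-- `M_i`: the unit vectors `x` with `⟨P₀ x, x⟩ = ⋯ = ⟨P_i x, x⟩ = 0`. -/
def cliffordM (P : Fin (m + 1) → Matrix (Fin (2 * l)) (Fin (2 * l)) ℝ) (i : ℕ) :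
    Set (EuclideanSpace ℝ (Fin (2 * l))) :=
  {x ∈ Metric.sphere 0 1 | ∀ α : Fin (m + 1), (α : ℕ) ≤ i → cliffordForm (P α) x = 0}

/-- `N_i`: the unit vectors `x` with `⟨P₀ x, x⟩² + ⋯ + ⟨P_i x, x⟩² = 1`. -/
def cliffordN (P : Fin (m + 1) → Matrix (Fin (2 * l)) (Fin (2 * l)) ℝ) (i : ℕ) :
    Set (EuclideanSpace ℝ (Fin (2 * l))) :=
  {x ∈ Metric.sphere 0 1 |
    ∑ α ∈ Finset.univ.filter (fun α : Fin (m + 1) => (α : ℕ) ≤ i), cliffordForm (P α) x ^ 2 = 1}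

end Clifford

end

/-! Both parts are instances of one situation, `IsFocalPair`. Let P be a symmetric involution with
trace zero, f(x) = ⟨Px, x⟩, and let M be a d-dimensional submanifold of the unit sphere of ℝ^{2l}
that contains the unit eigenvectors of P. Suppose that Px − f(x)x is tangent to M and that P,
compressed to the normal space of M in the sphere, is the scalar −f(x). Then ∇f = 2(Px − fx), whence
|∇f|² = 4(1 − f²). Since tr P = 0, the trace of P over the tangent space is minus the trace over its
complement, which the scalar condition evaluates; this gives Δf = −4(d + 1 − l)f.

The level f = c has unit normal (Px − cx)/s with s = √(1 − c²), so κ is a principal curvature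
exactly when μ = c − sκ is an eigenvalue of the compression of P to the tangent space of the level.
If Pv = μv + n is the eigenvector equation, then n is normal to M, and P² = 1 with the scalar
condition gives (μ − c)|n|² = 0: either n = 0 and μ = ±1, or μ = c
(`IsFocalTangent.eq_of_mem_compressionEigenspace`). The multiplicities are dimension counts, and the
focal sets are the unit spheres of the two eigenspaces of P.

For M_i the normal space in the sphere is spanned by the P_α x with α ≤ i, and P_{i+1} anticommutes
with these P_α. For N_i put Q_x = ∑ ⟨P_α x, x⟩ P_α. Equality in Cauchy–Schwarz turns the defining
equation into Q_x x = x, normal vectors satisfy Q_x w = −w, and Q_x P_β + P_β Q_x = 2⟨P_β x, x⟩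
yields the scalar condition. The equation Q_x x = x is overdetermined, and
`definesNear_of_projection` extracts a submersion from it. The minimality of the inclusions is a
separate trace computation. -/

noncomputable section

open Set Filter Topology Function InnerProductSpace
set_option linter.unusedSectionVars false

/-! ### Local defining submersions, tangent spaces and regular level sets -/

section SubmanifoldTheory

variable {V : Type*} [NormedAddCommGroup V] [InnerProductSpace ℝ V] [FiniteDimensional ℝ V]
variable {E : Type*} [NormedAddCommGroup E] [NormedSpace ℝ E] [FiniteDimensional ℝ E]

/-- Near `x`, the set `M` is the zero set of the smooth map `ψ`, a submersion at `x`. -/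
def DefinesNear (M : Set V) (ψ : V → E) (x : V) : Prop :=
  ∃ U : Set V, IsOpen U ∧ x ∈ U ∧ ContDiffOn ℝ ∞ ψ U ∧ M ∩ U = {y ∈ U | ψ y = 0} ∧
    Surjective (fderiv ℝ ψ x)

/-- If R is a right inverse of L, then L' ∘ R is close to the identity for L' near L, hence
invertible, and this produces preimages under L'. -/
theorem eventually_surjective_of_surjective {L : V →L[ℝ] E} (hL : Surjective L) :
    ∀ᶠ L' : V →L[ℝ] E in 𝓝 L, Surjective L' := by
  obtain ⟨R, hR⟩ := L.toLinearMap.exists_rightInverse_of_surjective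
    (LinearMap.range_eq_top.2 hL)
  let R' : E →L[ℝ] V := LinearMap.toContinuousLinearMap R
  have h1 : L ∘L R' = 1 := by
    ext v
    exact LinearMap.congr_fun hR v
  have hc : Continuous fun L' : V →L[ℝ] E => (L' ∘L R' : E →L[ℝ] E) := by fun_prop
  have := FiniteDimensional.complete ℝ E
  have ho : ∀ᶠ T : E →L[ℝ] E in 𝓝 (L ∘L R'), IsUnit T := by
    rw [h1]
    exact Units.isOpen.mem_nhds isUnit_one
  filter_upwards [hc.continuousAt.eventually ho] with L' hL' y
  obtain ⟨u, hu⟩ := hL'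
  refine ⟨R' ((↑u⁻¹ : E →L[ℝ] E) y), ?_⟩
  have : (u : E →L[ℝ] E) ((↑u⁻¹ : E →L[ℝ] E) y) = y := by
    rw [← mul_apply_eq_comp, Units.mul_inv]; rfl
  rw [hu] at this
  exact this

theorem DefinesNear.hasStrictFDerivAt {M : Set V} {ψ : V → E} {x : V} (h : DefinesNear M ψ x) :
    HasStrictFDerivAt ψ (fderiv ℝ ψ x) x := by
  obtain ⟨U, hU, hx, hψ, -, -⟩ := h
  exact (hψ.contDiffAt (hU.mem_nhds hx)).hasStrictFDerivAt (by simp)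

/-- The tangent space of a set on which a differentiable map vanishes. -/
theorem tangentSubspace_le_ker {M : Set V} {ψ : V → E} {ψ' : V →L[ℝ] E} {x : V} (hx : x ∈ M)
    (hψ : HasFDerivAt ψ ψ' x) (h0 : ∀ᶠ y in 𝓝 x, y ∈ M → ψ y = 0) :
    tangentSubspace M x ≤ ψ'.ker := by
  rw [tangentSubspace, Submodule.span_le]
  intro v hv
  have h1 : HasFDerivWithinAt ψ (0 : V →L[ℝ] E) M x := by
    refine (hasFDerivWithinAt_const (0 : E) x M).congr_of_eventuallyEq ?_ (h0.self_of_nhds hx)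
    filter_upwards [self_mem_nhdsWithin, nhdsWithin_le_nhds h0] with y hy h
    exact h hy
  simpa using hψ.hasFDerivWithinAt.unique_on h1 hv

theorem DefinesNear.tangentSubspace_eq {M : Set V} {ψ : V → E} {x : V} (h : DefinesNear M ψ x)
    (hx : x ∈ M) : tangentSubspace M x = (fderiv ℝ ψ x).ker := by
  have hs := h.hasStrictFDerivAt
  obtain ⟨U, hU, hxU, hψ, hM, hsurj⟩ := h
  have hψx : ψ x = 0 := by
    have : x ∈ {y ∈ U | ψ y = 0} := hM ▸ ⟨hx, hxU⟩
    exact this.2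
  apply le_antisymm
  · refine tangentSubspace_le_ker hx hs.hasFDerivAt ?_
    filter_upwards [hU.mem_nhds hxU] with y hy hyM
    have : y ∈ {y ∈ U | ψ y = 0} := hM ▸ ⟨hyM, hy⟩
    exact this.2
  · have hr : (fderiv ℝ ψ x).range = ⊤ := LinearMap.range_eq_top.2 hsurj
    -- For the reverse inclusion, the implicit function parametrizes M near x by the kernel, with
    -- derivative at 0 the inclusion of the kernel. The parameters that land in M form a
    -- neighbourhood of 0, so every kernel vector is a tangent direction.
    set g := hs.implicitFunction ψ (fderiv ℝ ψ x) hr (ψ x) with hg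
    have hg0 : g 0 = x := hs.implicitFunction_apply_image hr
    have hg' := hs.to_implicitFunction hr
    have hgc : Tendsto g (𝓝 0) (𝓝 x) := by
      have := hg'.hasFDerivAt.continuousAt.tendsto
      rwa [← hg, hg0] at this
    have h1 : ∀ᶠ w in 𝓝 (0 : (fderiv ℝ ψ x).ker), ψ (g w) = 0 := by
      have h2 := hs.map_implicitFunction_eq hr
      have hc : Tendsto (fun w : (fderiv ℝ ψ x).ker => (ψ x, w)) (𝓝 0) (𝓝 (ψ x, 0)) := by
        exact (Continuous.prodMk_right (ψ x)).tendsto 0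
      filter_upwards [hc.eventually h2] with w hw
      exact hw.trans hψx
    have h3 : {w | g w ∈ M} ∈ 𝓝 (0 : (fderiv ℝ ψ x).ker) := by
      filter_upwards [h1, hgc.eventually (hU.mem_nhds hxU)] with w hw hwU
      have : g w ∈ M ∩ U := hM ▸ ⟨hwU, hw⟩
      exact this.1
    intro v hv
    refine Submodule.subset_span ?_
    have h4 := (hg'.hasFDerivAt.hasFDerivWithinAt (s := {w | g w ∈ M})).mapsTo_tangent_cone
      (show (⟨v, hv⟩ : (fderiv ℝ ψ x).ker) ∈ _ by rw [tangentConeAt_of_mem_nhds h3]; trivial)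
    rw [← hg, hg0] at h4
    refine tangentConeAt_mono ?_ h4
    rintro _ ⟨w, hw, rfl⟩
    exact hw

/-- The chart of `IsEmbeddedSubmanifold` obtained from a local defining submersion. -/
theorem DefinesNear.exists_chart {M : Set V} {ψ : V → E} {x : V} (h : DefinesNear M ψ x) {d : ℕ}
    (hd : Module.finrank ℝ E + d = Module.finrank ℝ V) :
    ∃ (k : ℕ) (U : Set V) (φ : V → EuclideanSpace ℝ (Fin k)),
      k + d = Module.finrank ℝ V ∧ IsOpen U ∧ x ∈ U ∧ ContDiffOn ℝ ∞ φ U ∧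
        (∀ y ∈ U, Surjective (fderiv ℝ φ y)) ∧ M ∩ U = {y ∈ U | φ y = 0} := by
  obtain ⟨U, hU, hxU, hψ, hM, hsurj⟩ := h
  have hfin : Module.finrank ℝ E = Module.finrank ℝ (EuclideanSpace ℝ (Fin (Module.finrank ℝ E))) := by
    simp
  let e : E ≃L[ℝ] EuclideanSpace ℝ (Fin (Module.finrank ℝ E)) :=
    ContinuousLinearEquiv.ofFinrankEq hfin
  have hev : ∀ᶠ y in 𝓝 x, Surjective (fderiv ℝ ψ y) := by
    have hc : ContinuousAt (fderiv ℝ ψ) x :=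
      ((hψ.continuousOn_fderiv_of_isOpen hU (by simp)).continuousAt (hU.mem_nhds hxU))
    exact hc.eventually (eventually_surjective_of_surjective hsurj)
  obtain ⟨W, hW, hWo, hxW⟩ := mem_nhds_iff.1 hev
  refine ⟨_, U ∩ W, e ∘ ψ, hd, hU.inter hWo, ⟨hxU, hxW⟩, ?_, ?_, ?_⟩
  · exact e.contDiff.comp_contDiffOn (hψ.mono inter_subset_left)
  · rintro y ⟨hy, hyW⟩
    rw [e.comp_fderiv]
    exact e.surjective.comp (hW hyW)
  · rw [← inter_assoc, hM]
    ext y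
    simp only [mem_inter_iff, mem_ofPred_eq, comp_apply, EmbeddingLike.map_eq_zero_iff]
    tauto

theorem isEmbeddedSubmanifold_of_definesNear {M : Set V} {d : ℕ} {ψ : V → V → E}
    (h : ∀ x ∈ M, DefinesNear M (ψ x) x)
    (hd : M.Nonempty → Module.finrank ℝ E + d = Module.finrank ℝ V) :
    IsEmbeddedSubmanifold M d :=
  fun x hx => (h x hx).exists_chart (hd ⟨x, hx⟩)

theorem IsEmbeddedSubmanifold.exists_definesNear {M : Set V} {d : ℕ}
    (h : IsEmbeddedSubmanifold M d) {x : V} (hx : x ∈ M) :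
    ∃ (k : ℕ) (φ : V → EuclideanSpace ℝ (Fin k)),
      k + d = Module.finrank ℝ V ∧ DefinesNear M φ x := by
  obtain ⟨k, U, φ, hk, hU, hxU, hφ, hs, hM⟩ := h x hx
  exact ⟨k, φ, hk, U, hU, hxU, hφ, hM, hs x hxU⟩

theorem DefinesNear.finrank_tangentSubspace {M : Set V} {ψ : V → E} {x : V}
    (h : DefinesNear M ψ x) (hx : x ∈ M) :
    Module.finrank ℝ E + Module.finrank ℝ (tangentSubspace M x) = Module.finrank ℝ V := by
  rw [h.tangentSubspace_eq hx]
  obtain ⟨-, -, -, -, -, hsurj⟩ := h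
  have := LinearMap.finrank_range_add_finrank_ker (fderiv ℝ ψ x).toLinearMap
  rw [LinearMap.range_eq_top.2 hsurj, finrank_top] at this
  exact this

theorem IsEmbeddedSubmanifold.finrank_tangentSubspace {M : Set V} {d : ℕ}
    (h : IsEmbeddedSubmanifold M d) {x : V} (hx : x ∈ M) :
    Module.finrank ℝ (tangentSubspace M x) = d := by
  obtain ⟨k, φ, hk, hφ⟩ := h.exists_definesNear hx
  have := hφ.finrank_tangentSubspace hx
  rw [finrank_euclideanSpace_fin] at this
  omega

/-- A defining submersion of a regular level set. -/
theorem DefinesNear.levelSet {M : Set V} {ψ : V → E} {x : V} (h : DefinesNear M ψ x) {f : V → ℝ}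
    (hf : ContDiff ℝ ∞ f) (c : ℝ) {v : V} (hv : fderiv ℝ ψ x v = 0) (hfv : fderiv ℝ f x v ≠ 0) :
    DefinesNear (levelSet M f c) (fun y => (ψ y, f y - c)) x := by
  have hs := h.hasStrictFDerivAt
  obtain ⟨U, hU, hxU, hψ, hM, hsurj⟩ := h
  refine ⟨U, hU, hxU, hψ.prodMk ((hf.sub contDiff_const).contDiffOn), ?_, ?_⟩
  · ext y
    have hy : (y ∈ M ∧ y ∈ U) ↔ (y ∈ U ∧ ψ y = 0) := by
      have := congrArg (y ∈ ·) hM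
      simpa using this
    simp only [_root_.levelSet, mem_inter_iff, mem_ofPred_eq, Prod.mk_eq_zero, sub_eq_zero]
    tauto
  · have hd : HasFDerivAt (fun y => (ψ y, f y - c)) ((fderiv ℝ ψ x).prod (fderiv ℝ f x)) x :=
      hs.hasFDerivAt.prodMk ((hf.differentiable (by simp) x).hasFDerivAt.sub_const c)
    rw [hd.fderiv]
    rintro ⟨a, b⟩
    obtain ⟨w, hw⟩ := hsurj a
    -- Moving along v leaves the first component alone and adjusts the second one freely.
    refine ⟨w + ((b - fderiv ℝ f x w) / fderiv ℝ f x v) • v, ?_⟩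
    rw [map_add, map_smul, ContinuousLinearMap.prod_apply, ContinuousLinearMap.prod_apply, hv, hw,
      Prod.smul_mk, Prod.mk_add_mk, smul_zero, add_zero, smul_eq_mul, div_mul_cancel₀ _ hfv,
      add_sub_cancel]

theorem DefinesNear.tangentSubspace_levelSet {M : Set V} {ψ : V → E} {x : V}
    (h : DefinesNear M ψ x) {f : V → ℝ} (hf : ContDiff ℝ ∞ f) {c : ℝ} {v : V}
    (hv : fderiv ℝ ψ x v = 0) (hfv : fderiv ℝ f x v ≠ 0) (hx : x ∈ _root_.levelSet M f c) :
    tangentSubspace (_root_.levelSet M f c) x = tangentSubspace M x ⊓ (fderiv ℝ f x).ker := by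
  rw [(h.levelSet hf c hv hfv).tangentSubspace_eq hx, h.tangentSubspace_eq hx.1]
  have hd : HasFDerivAt (fun y => (ψ y, f y - c)) ((fderiv ℝ ψ x).prod (fderiv ℝ f x)) x :=
      h.hasStrictFDerivAt.hasFDerivAt.prodMk
        ((hf.differentiable (by simp) x).hasFDerivAt.sub_const c)
  rw [hd.fderiv]
  ext w
  simp

theorem isEmbeddedSubmanifold_levelSet {M : Set V} {d : ℕ} (hM : IsEmbeddedSubmanifold M (d + 1))
    {f : V → ℝ} (hf : ContDiff ℝ ∞ f) {c : ℝ}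
    (h : ∀ x ∈ levelSet M f c, ∃ v ∈ tangentSubspace M x, fderiv ℝ f x v ≠ 0) :
    IsEmbeddedSubmanifold (levelSet M f c) d := by
  intro x hx
  obtain ⟨k, φ, hk, hφ⟩ := hM.exists_definesNear hx.1
  obtain ⟨v, hv, hfv⟩ := h x hx
  rw [hφ.tangentSubspace_eq hx.1] at hv
  refine (hφ.levelSet hf c hv hfv).exists_chart ?_
  simp
  omega

theorem IsEmbeddedSubmanifold.tangentSubspace_levelSet {M : Set V} {d : ℕ}
    (hM : IsEmbeddedSubmanifold M d) {f : V → ℝ} (hf : ContDiff ℝ ∞ f) {c : ℝ} {x : V}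
    (hx : x ∈ levelSet M f c) (h : ∃ v ∈ tangentSubspace M x, fderiv ℝ f x v ≠ 0) :
    tangentSubspace (levelSet M f c) x = tangentSubspace M x ⊓ (fderiv ℝ f x).ker := by
  obtain ⟨k, φ, hk, hφ⟩ := hM.exists_definesNear hx.1
  obtain ⟨v, hv, hfv⟩ := h
  rw [hφ.tangentSubspace_eq hx.1] at hv
  exact hφ.tangentSubspace_levelSet hf hv hfv hx

/-- A set with equations `F` that take their values in moving subspaces `range (B y)` is near `x`
the zero set of the projected equations. -/
theorem definesNear_of_projection {M : Set V} {F : V → V} {B : V → V →L[ℝ] V} {A F' : V →L[ℝ] V}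
    {x : V} {U : Set V} (hU : IsOpen U) (hxU : x ∈ U) (hF : ContDiffOn ℝ ∞ F U)
    (hMU : M ∩ U = {y ∈ U | F y = 0}) (hB : ContinuousAt B x) (hBx : B x = A)
    (hBF : ∀ y ∈ U, B y (F y) = F y) (hF' : HasFDerivAt F F' x) (hAF : A ∘L F' = A) :
    DefinesNear M (fun y => A.toLinearMap.rangeRestrict (F y)) x := by
  have hlt : ∀ᶠ y in 𝓝 x, ‖B y - A‖ < 1 := by
    have hc : Tendsto (fun y => ‖B y - A‖) (𝓝 x) (𝓝 ‖B x - A‖) := (hB.sub continuousAt_const).norm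
    rw [hBx, sub_self, norm_zero] at hc
    exact hc.eventually (gt_mem_nhds one_pos)
  obtain ⟨W, hW, hWo, hxW⟩ := mem_nhds_iff.1 hlt
  let A' : V →L[ℝ] A.toLinearMap.range := A.rangeRestrict
  refine ⟨U ∩ W, hU.inter hWo, ⟨hxU, hxW⟩,
    A'.contDiff.comp_contDiffOn (hF.mono inter_subset_left), ?_, ?_⟩
  · rw [← inter_assoc, hMU]
    ext y
    simp only [mem_inter_iff, mem_ofPred_eq]
    constructor
    · rintro ⟨⟨hy, h0⟩, hyW⟩
      exact ⟨⟨hy, hyW⟩, by rw [h0, map_zero]⟩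
    · rintro ⟨⟨hy, hyW⟩, h0⟩
      refine ⟨⟨hy, ?_⟩, hyW⟩
      have hA0 : A (F y) = 0 := congrArg Subtype.val h0
      -- A zero of the projected equations is fixed by `B y - A`, which has norm less than 1; so it
      -- is a zero of `F`.
      have h1 : F y = (B y - A) (F y) := by simp [hBF y hy, hA0]
      by_contra hne
      have h2 : ‖F y‖ ≤ ‖B y - A‖ * ‖F y‖ := by
        conv_lhs => rw [h1]
        exact (B y - A).le_opNorm _
      have h3 : ‖B y - A‖ < 1 := hW hyW
      nlinarith [norm_pos_iff.2 hne]
  · have hd : HasFDerivAt (fun y => A' (F y)) (A' ∘L F') x := A'.hasFDerivAt.comp x hF'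
    have he : (fun y => A.toLinearMap.rangeRestrict (F y)) = fun y => A' (F y) := rfl
    rw [he, hd.fderiv]
    rintro ⟨_, w, rfl⟩
    exact ⟨w, Subtype.ext (DFunLike.congr_fun hAF w)⟩

theorem fderiv_rangeRestrict_comp {F : V → V} {A F' : V →L[ℝ] V} {x : V} (hF' : HasFDerivAt F F' x)
    (hAF : A ∘L F' = A) :
    (fderiv ℝ (fun y => A.toLinearMap.rangeRestrict (F y)) x).ker = A.ker := by
  have hd : HasFDerivAt (fun y => A.rangeRestrict (F y)) (A.rangeRestrict ∘L F') x :=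
    A.rangeRestrict.hasFDerivAt.comp x hF'
  have he : (fun y => A.toLinearMap.rangeRestrict (F y)) = fun y => A.rangeRestrict (F y) := rfl
  rw [he, hd.fderiv]
  ext w
  have := DFunLike.congr_fun hAF w
  simp only [LinearMap.mem_ker, ContinuousLinearMap.coe_coe, ContinuousLinearMap.comp_apply] at *
  rw [← this, Subtype.ext_iff]
  rfl

/-- The differential along `M` of a map that agrees on `M` with a differentiable map. -/
theorem fderivWithin_apply_of_mem_tangentSubspace {M : Set V} {f g : V → E} {g' : V →L[ℝ] E}
    {x : V} (hx : x ∈ M) (hg : HasFDerivAt g g' x) (hfg : ∀ y ∈ M, f y = g y) {v : V}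
    (hv : v ∈ tangentSubspace M x) : fderivWithin ℝ f M x v = g' v := by
  have h1 : HasFDerivWithinAt f g' M x :=
    hg.hasFDerivWithinAt.congr (fun y hy => hfg y hy) (hfg x hx)
  have h2 := h1.differentiableWithinAt.hasFDerivWithinAt
  have h3 := h2.unique_on h1
  have h4 : tangentSubspace M x ≤ LinearMap.eqLocus (fderivWithin ℝ f M x).toLinearMap g'.toLinearMap :=
    Submodule.span_le.2 fun w hw => h3 hw
  exact h4 hv

theorem starProjection_eq_of_mem {K : Submodule ℝ V} {u w : V} (hu : u ∈ K)
    (h : ∀ v ∈ K, inner ℝ v (w - u) = 0) : K.starProjection w = u :=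
  (K.eq_starProjection_of_mem_orthogonal hu ((K.mem_orthogonal _).2 h))

end SubmanifoldTheory

/-! ### Gradients, second fundamental forms and traces through ambient extensions -/

section RiemannianGeometry

variable {V : Type*} [NormedAddCommGroup V] [InnerProductSpace ℝ V] [FiniteDimensional ℝ V]

theorem covariantDifferential_apply {M : Set V} {Y G : V → V} {G' : V →L[ℝ] V} {x : V} (hx : x ∈ M)
    (hG : HasFDerivAt G G' x) (hYG : ∀ y ∈ M, Y y = G y) (v : tangentSubspace M x) :
    covariantDifferential M Y x v = (tangentSubspace M x).orthogonalProjectionOnto (G' v) := by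
  rw [← fderivWithin_apply_of_mem_tangentSubspace hx hG hYG v.2]
  rfl

theorem secondFundamentalForm_eq {S M : Set V} {x X Y : V} {G : V → V} {G' : V →L[ℝ] V}
    (hx : x ∈ S) (hX : X ∈ tangentSubspace S x) (hG : HasFDerivAt G G' x)
    (hYG : ∀ y ∈ S, (tangentSubspace S y).starProjection Y = G y) :
    secondFundamentalForm S M x X Y =
      (tangentSubspace M x).starProjection (G' X) - (tangentSubspace S x).starProjection (G' X) := by
  simp only [secondFundamentalForm, fderivWithin_apply_of_mem_tangentSubspace hx hG hYG hX]

theorem submanifoldGradient_eq {M : Set V} {f : V → ℝ} {x g : V} (hx : x ∈ M)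
    (hf : HasFDerivAt f (innerSL ℝ g) x) :
    submanifoldGradient M f x = (tangentSubspace M x).starProjection g := by
  rw [submanifoldGradient]
  refine starProjection_eq_of_mem (Submodule.starProjection_apply_mem _ _) fun v hv => ?_
  have h1 := (tangentSubspace M x).starProjection_inner_eq_zero g v hv
  rw [inner_sub_left] at h1
  rw [inner_sub_right, real_inner_comm, InnerProductSpace.toDual_symm_apply,
    fderivWithin_apply_of_mem_tangentSubspace hx hf (fun _ _ => rfl) hv, innerSL_apply_apply,
    real_inner_comm _ v]
  exact h1

/-- By cyclicity of the trace, a sum over a basis of the tangent space becomes the trace of an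
ambient operator, which explicit formulas for the projection then evaluate. -/
theorem sum_inner_orthonormalBasis {ι : Type*} [Fintype ι] (K : Submodule ℝ V)
    (b : OrthonormalBasis ι ℝ K) (L : V →L[ℝ] V) :
    ∑ a, inner ℝ (L (b a : V)) (b a : V) =
      LinearMap.trace ℝ V (L ∘L K.starProjection).toLinearMap := by
  have h1 : (L ∘L K.starProjection).toLinearMap =
      (L.toLinearMap ∘ₗ K.subtype) ∘ₗ K.orthogonalProjectionOnto.toLinearMap := rfl
  rw [h1, LinearMap.trace_comp_comm', LinearMap.trace_eq_sum_inner _ b]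
  refine Finset.sum_congr rfl fun a _ => ?_
  rw [real_inner_comm]
  simp

theorem trace_compression (K : Submodule ℝ V) (L : V →L[ℝ] V) :
    LinearMap.trace ℝ K (K.orthogonalProjectionOnto ∘L L ∘L K.subtypeL : K →L[ℝ] K).toLinearMap =
      ∑ a, inner ℝ (L (stdOrthonormalBasis ℝ K a : V)) (stdOrthonormalBasis ℝ K a : V) := by
  rw [LinearMap.trace_eq_sum_inner _ (stdOrthonormalBasis ℝ K)]
  refine Finset.sum_congr rfl fun a _ => ?_
  rw [real_inner_comm]
  simp

theorem trace_eq_sum_inner_add_sum_inner_orthogonal (K : Submodule ℝ V) (L : V →L[ℝ] V) :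
    LinearMap.trace ℝ V L.toLinearMap =
      (∑ a, inner ℝ (L (stdOrthonormalBasis ℝ K a : V)) (stdOrthonormalBasis ℝ K a : V)) +
      ∑ a, inner ℝ (L (stdOrthonormalBasis ℝ Kᗮ a : V)) (stdOrthonormalBasis ℝ Kᗮ a : V) := by
  rw [sum_inner_orthonormalBasis, sum_inner_orthonormalBasis, ← map_add]
  congr 1
  ext v
  simp

end RiemannianGeometry

/-! ### Symmetric involutions with eigenspaces of equal dimension -/

section Involution

variable {V : Type*} [NormedAddCommGroup V] [InnerProductSpace ℝ V] [FiniteDimensional ℝ V]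

/-- The quadratic form of an operator. -/
def quadForm (P : V →L[ℝ] V) (x : V) : ℝ := inner ℝ (P x) x

/-- The subspace of the fixed vectors of an operator. -/
def fixedSpace (P : V →L[ℝ] V) : Submodule ℝ V := LinearMap.eqLocus P.toLinearMap LinearMap.id

@[simp] theorem mem_fixedSpace {P : V →L[ℝ] V} {v : V} : v ∈ fixedSpace P ↔ P v = v := Iff.rfl

theorem mem_fixedSpace_neg {P : V →L[ℝ] V} {v : V} : v ∈ fixedSpace (-P) ↔ P v = -v := by
  rw [mem_fixedSpace, neg_apply, neg_eq_iff_eq_neg]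

/-- A symmetric orthogonal involution that is conjugate to its negative. -/
structure IsBalancedInvolution (P : V →L[ℝ] V) : Prop where
  symm : ∀ x y, inner ℝ (P x) y = inner ℝ x (P y)
  sq : ∀ x, P (P x) = x
  swap : ∃ B : V →L[ℝ] V, (∀ x, B (B x) = x) ∧ ∀ x, B (P x) = -P (B x)

theorem contDiff_quadForm (P : V →L[ℝ] V) : ContDiff ℝ ∞ (quadForm P) :=
  P.contDiff.inner ℝ contDiff_id

theorem hasFDerivAt_quadForm {P : V →L[ℝ] V} (h : ∀ x y, inner ℝ (P x) y = inner ℝ x (P y)) (x : V) :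
    HasFDerivAt (quadForm P) (innerSL ℝ ((2 : ℝ) • P x)) x := by
  refine (P.hasFDerivAt.inner ℝ (hasFDerivAt_id x)).congr_fderiv ?_
  ext v
  have h1 : inner ℝ (P v) x = inner ℝ (P x) v := by rw [h v x, real_inner_comm]
  simp [fderivInnerCLM_apply, h1]
  ring

theorem fderiv_quadForm {P : V →L[ℝ] V} (h : ∀ x y, inner ℝ (P x) y = inner ℝ x (P y)) (x v : V) :
    fderiv ℝ (quadForm P) x v = 2 * inner ℝ (P x) v := by
  rw [(hasFDerivAt_quadForm h x).fderiv, innerSL_apply_apply, inner_smul_left]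
  rfl

theorem quadForm_id (x : V) : quadForm (.id ℝ V) x = ‖x‖ ^ 2 := real_inner_self_eq_norm_sq x

theorem quadForm_neg (P : V →L[ℝ] V) (x : V) : quadForm (-P) x = -quadForm P x := by
  simp [quadForm]

namespace IsBalancedInvolution

variable {P : V →L[ℝ] V} (h : IsBalancedInvolution P)
include h

theorem neg : IsBalancedInvolution (-P) where
  symm x y := by simp [h.symm]
  sq x := by simp [h.sq]
  swap := by
    obtain ⟨B, hB, hBP⟩ := h.swap
    exact ⟨B, hB, fun x => by simp [hBP]⟩

theorem inner_map_map (x y : V) : inner ℝ (P x) (P y) = inner ℝ x y := by rw [h.symm, h.sq]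

theorem norm_map (x : V) : ‖P x‖ = ‖x‖ := by
  rw [← sq_eq_sq₀ (norm_nonneg _) (norm_nonneg _), ← real_inner_self_eq_norm_sq, h.inner_map_map,
    real_inner_self_eq_norm_sq]

/-- The conjugation B P B = −P preserves the trace. -/
theorem trace_eq_zero : LinearMap.trace ℝ V P.toLinearMap = 0 := by
  obtain ⟨B, hB, hBP⟩ := h.swap
  have h1 : P.toLinearMap = (P.toLinearMap ∘ₗ B.toLinearMap) ∘ₗ B.toLinearMap := by
    ext v
    simp [hB]
  have h2 : B.toLinearMap ∘ₗ (P.toLinearMap ∘ₗ B.toLinearMap) = -P.toLinearMap := by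
    ext v
    simp [hB, hBP]
  have h3 : LinearMap.trace ℝ V P.toLinearMap = -LinearMap.trace ℝ V P.toLinearMap := by
    conv_lhs => rw [h1, LinearMap.trace_comp_comm', h2, map_neg]
  linarith

theorem orthogonal_fixedSpace : (fixedSpace P)ᗮ = fixedSpace (-P) := by
  ext v
  rw [Submodule.mem_orthogonal, mem_fixedSpace_neg]
  constructor
  · intro hv
    -- The vector v + Pv is fixed, hence orthogonal to v; expanding its square norm then shows that
    -- it vanishes.
    have h1 := hv (v + P v) (by simp [h.sq, add_comm])
    have h2 : ‖v + P v‖ ^ 2 = 0 := by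
      rw [← real_inner_self_eq_norm_sq, inner_add_right, h1, ← h.symm, map_add, h.sq, add_comm (P v),
        h1, add_zero]
    rw [sq_eq_zero_iff, norm_eq_zero] at h2
    exact eq_neg_of_add_eq_zero_right h2
  · intro hv u hu
    rw [mem_fixedSpace] at hu
    have h1 := h.symm u v
    rw [hu, hv, inner_neg_right] at h1
    linarith

theorem inner_eq_zero {u v : V} (hu : P u = u) (hv : P v = -v) : inner ℝ u v = 0 := by
  have h1 := h.symm u v
  rw [hu, hv, inner_neg_right] at h1
  linarith

/-- The operator B exchanges the two eigenspaces, which are orthogonal complements of each other. -/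
theorem finrank_fixedSpace {l : ℕ} (hl : Module.finrank ℝ V = 2 * l) :
    Module.finrank ℝ (fixedSpace P) = l := by
  obtain ⟨B, hB, hBP⟩ := h.swap
  have h1 := (fixedSpace P).finrank_add_finrank_orthogonal
  rw [h.orthogonal_fixedSpace] at h1
  let e : V ≃ₗ[ℝ] V := LinearEquiv.ofInvolutive B.toLinearMap hB
  have h2 : (fixedSpace P).map e.toLinearMap = fixedSpace (-P) := by
    ext v
    rw [mem_fixedSpace_neg]
    constructor
    · rintro ⟨u, hu, rfl⟩
      have h3 := hBP u
      rw [mem_fixedSpace.1 hu] at h3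
      exact eq_neg_of_add_eq_zero_left (by rw [show e.toLinearMap u = B u from rfl]; nth_rw 2 [h3]; simp)
    · intro hv
      refine ⟨B v, ?_, hB v⟩
      have h3 := hBP v
      rw [hv, map_neg, neg_inj] at h3
      exact h3.symm
  have h3 := LinearEquiv.finrank_map_eq e (fixedSpace P)
  rw [h2] at h3
  omega

theorem quadForm_mem_Icc {x : V} (hx : ‖x‖ = 1) : quadForm P x ∈ Icc (-1 : ℝ) 1 := by
  have h1 := abs_real_inner_le_norm (P x) x
  rw [h.norm_map, hx, one_mul] at h1
  exact abs_le.1 h1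

theorem quadForm_eq_one_iff {x : V} (hx : ‖x‖ = 1) : quadForm P x = 1 ↔ P x = x := by
  have h1 := norm_sub_sq_real (P x) x
  rw [h.norm_map, hx] at h1
  constructor
  · intro h2
    rw [quadForm] at h2
    rw [h2] at h1
    have : ‖P x - x‖ ^ 2 = 0 := by linarith
    rwa [sq_eq_zero_iff, norm_eq_zero, sub_eq_zero] at this
  · intro h2
    rw [quadForm, h2, real_inner_self_eq_norm_sq, hx, one_pow]

end IsBalancedInvolution

end Involution

theorem finrank_map_of_disjoint_ker {V W : Type*} [AddCommGroup V] [Module ℝ V] [AddCommGroup W]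
    [Module ℝ W] {φ : V →ₗ[ℝ] W} {K : Submodule ℝ V} (h : Disjoint K (LinearMap.ker φ)) :
    Module.finrank ℝ (K.map φ) = Module.finrank ℝ K := by
  have hinj : Injective (φ.domRestrict K) := by
    rw [← LinearMap.ker_eq_bot, LinearMap.ker_domRestrict, ← Submodule.disjoint_iff_comap_eq_bot]
    exact h
  rw [← LinearMap.range_domRestrict, LinearMap.finrank_range_of_inj hinj]

/-! ### Linear algebra at one point: compressions of P to the tangent spaces -/

section FocalTangent

variable {V : Type*} [NormedAddCommGroup V] [InnerProductSpace ℝ V] [FiniteDimensional ℝ V]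

/-- The eigenvectors for `μ` of the compression of `P` to `K`. -/
def compressionEigenspace (P : V →L[ℝ] V) (K : Submodule ℝ V) (μ : ℝ) : Submodule ℝ V :=
  K ⊓ Kᗮ.comap (P - μ • ContinuousLinearMap.id ℝ V).toLinearMap

theorem mem_compressionEigenspace {P : V →L[ℝ] V} {K : Submodule ℝ V} {μ : ℝ} {v : V} :
    v ∈ compressionEigenspace P K μ ↔ v ∈ K ∧ P v - μ • v ∈ Kᗮ := Iff.rfl

/-- The tangent space `T` at `x` of a submanifold of the sphere on whose normal space, in the
sphere, the compression of `P` is scalar. -/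
structure IsFocalTangent (P : V →L[ℝ] V) (T : Submodule ℝ V) (x : V) : Prop where
  unit : ‖x‖ = 1
  perp : ∀ v ∈ T, inner ℝ x v = 0
  grad : P x - quadForm P x • x ∈ T
  normal : ∀ w ∈ Tᗮ, ∀ w' ∈ Tᗮ, inner ℝ x w = 0 → inner ℝ x w' = 0 →
    inner ℝ (P w) w' = -quadForm P x * inner ℝ w w'

/-- The tangent space of the level set of the quadratic form of `P`. -/
def levelTangent (P : V →L[ℝ] V) (T : Submodule ℝ V) (x : V) : Submodule ℝ V := T ⊓ (ℝ ∙ P x)ᗮ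

theorem mem_levelTangent {P : V →L[ℝ] V} {T : Submodule ℝ V} {x v : V} :
    v ∈ levelTangent P T x ↔ v ∈ T ∧ inner ℝ (P x) v = 0 := by
  rw [levelTangent, Submodule.mem_inf, Submodule.mem_orthogonal_singleton_iff_inner_right]

namespace IsFocalTangent

variable {P : V →L[ℝ] V} {T : Submodule ℝ V} {x : V}

theorem neg (h : IsFocalTangent P T x) : IsFocalTangent (-P) T x where
  unit := h.unit
  perp := h.perp
  grad := by
    have := T.neg_mem h.grad
    rw [quadForm_neg, neg_apply]
    convert this using 1
    module
  normal w hw w' hw' h1 h2 := by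
    rw [neg_apply, inner_neg_left, h.normal w hw w' hw' h1 h2, quadForm_neg]
    ring

theorem base_mem (h : IsFocalTangent P T x) : x ∈ Tᗮ :=
  (T.mem_orthogonal' x).2 h.perp

theorem inner_self (h : IsFocalTangent P T x) : inner ℝ x x = 1 := by
  rw [real_inner_self_eq_norm_sq, h.unit, one_pow]

theorem inner_map_normal (h : IsFocalTangent P T x) {w : V} (hw : w ∈ Tᗮ) :
    inner ℝ (P x) w = quadForm P x * inner ℝ x w := by
  have h1 := (T.mem_orthogonal w).1 hw _ h.grad
  rw [inner_sub_left, inner_smul_left] at h1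
  simpa [sub_eq_zero] using h1

/-- Here w need not be orthogonal to x. In the splitting of w along x the cross terms vanish; the
x-part carries the eigenvalue +f instead of −f, which accounts for the correction 2f⟨x, w⟩². -/
theorem inner_map_self_normal (hP : IsBalancedInvolution P) (h : IsFocalTangent P T x) {w : V}
    (hw : w ∈ Tᗮ) :
    inner ℝ (P w) w = -quadForm P x * inner ℝ w w + 2 * quadForm P x * inner ℝ x w ^ 2 := by
  have h1 : w - inner ℝ x w • x ∈ Tᗮ := Tᗮ.sub_mem hw (Tᗮ.smul_mem _ h.base_mem)
  have h2 : inner ℝ x (w - inner ℝ x w • x) = 0 := by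
    rw [inner_sub_right, inner_smul_right, h.inner_self]; ring
  have h3 := h.normal _ h1 _ h1 h2 h2
  have h4 : inner ℝ (P w) x = quadForm P x * inner ℝ x w := by
    rw [hP.symm, real_inner_comm, h.inner_map_normal hw]
  have h5 : inner ℝ (P x) x = quadForm P x := rfl
  simp only [map_sub, map_smul, inner_sub_left, inner_sub_right, inner_smul_left, inner_smul_right,
    h.inner_map_normal hw, h4, h5, h.inner_self, ← real_inner_comm w x] at h3
  simp only [conj_trivial] at h3
  linear_combination h3

/-- The total trace is zero, so the trace over T is minus the trace over Tᗮ. The latter is f from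
the direction x and −f from each of the remaining directions. -/
theorem trace_compression (hP : IsBalancedInvolution P) (h : IsFocalTangent P T x) :
    ∑ a, inner ℝ (P (stdOrthonormalBasis ℝ T a : V)) (stdOrthonormalBasis ℝ T a : V) =
      quadForm P x * (Module.finrank ℝ Tᗮ - 2) := by
  have h1 := trace_eq_sum_inner_add_sum_inner_orthogonal T P
  rw [hP.trace_eq_zero] at h1
  have h2 : ∀ a, inner ℝ (P (stdOrthonormalBasis ℝ Tᗮ a : V)) (stdOrthonormalBasis ℝ Tᗮ a : V) =
      -quadForm P x + 2 * quadForm P x *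
        inner ℝ (stdOrthonormalBasis ℝ Tᗮ a) (⟨x, h.base_mem⟩ : Tᗮ) ^ 2 := by
    intro a
    rw [h.inner_map_self_normal hP (stdOrthonormalBasis ℝ Tᗮ a).2, real_inner_self_eq_norm_sq,
      Submodule.norm_coe, (stdOrthonormalBasis ℝ Tᗮ).norm_eq_one, Submodule.coe_inner,
      real_inner_comm x]
    ring
  have h3 := (stdOrthonormalBasis ℝ Tᗮ).sum_sq_norm_inner_right (⟨x, h.base_mem⟩ : Tᗮ)
  simp only [Real.norm_eq_abs, sq_abs] at h3
  rw [Finset.sum_congr rfl fun a _ => h2 a, Finset.sum_add_distrib, ← Finset.mul_sum, h3,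
    ← Submodule.norm_coe, h.unit] at h1
  simp at h1
  linarith

/-- A fixed vector v satisfies ⟨w + Pw, v⟩ = 2⟨w, v⟩, so it lies in T exactly when it is orthogonal
to (1 + P)Tᗮ. The map 1 + P is injective on Tᗮ, and the fixed space has dimension l. -/
theorem finrank_fixedSpace_inf (hP : IsBalancedInvolution P) (h : IsFocalTangent P T x)
    (hc : |quadForm P x| < 1) {l : ℕ} (hl : Module.finrank ℝ V = 2 * l) :
    Module.finrank ℝ (fixedSpace P ⊓ T : Submodule ℝ V) + Module.finrank ℝ Tᗮ = l := by
  obtain ⟨hc1, hc2⟩ := abs_lt.1 hc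
  let φ : V →ₗ[ℝ] V := LinearMap.id + P.toLinearMap
  have hφ : ∀ w, φ w = w + P w := fun _ => rfl
  have hinj : Disjoint Tᗮ (LinearMap.ker φ) := by
    rw [Submodule.disjoint_def]
    intro w hw hw0
    rw [LinearMap.mem_ker, hφ] at hw0
    have h1 := h.inner_map_self_normal hP hw
    rw [eq_neg_of_add_eq_zero_right hw0, inner_neg_left] at h1
    have h2 : inner ℝ x w ^ 2 ≤ inner ℝ w w := by
      rw [real_inner_self_eq_norm_sq, ← sq_abs]
      have := abs_real_inner_le_norm x w
      rw [h.unit, one_mul] at this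
      gcongr
    have h3 : (0 : ℝ) ≤ inner ℝ w w := real_inner_self_nonneg
    have h4 : inner ℝ w w = (0 : ℝ) := by
      -- From Pw = −w one gets (1 − f)|w|² + 2f⟨x, w⟩² = 0. For f ≥ 0 this forces w = 0 at once; for
      -- f ≤ 0, the bound ⟨x, w⟩² ≤ |w|² leaves (1 + f)|w|² ≤ 0.
      rcases le_total 0 (quadForm P x) with h5 | h5
      · nlinarith [mul_nonneg h5 (sq_nonneg (inner ℝ x w))]
      · nlinarith [mul_nonneg (neg_nonneg.2 h5) (sub_nonneg.2 h2)]
    exact inner_self_eq_zero.1 h4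
  have hle : Tᗮ.map φ ≤ fixedSpace P := by
    rintro _ ⟨w, -, rfl⟩
    rw [mem_fixedSpace, hφ, map_add, hP.sq, add_comm]
  have h1 := Submodule.finrank_add_inf_finrank_orthogonal hle
  have h2 : (Tᗮ.map φ)ᗮ ⊓ fixedSpace P = fixedSpace P ⊓ T := by
    ext v
    rw [inf_comm, Submodule.mem_inf, Submodule.mem_inf, and_congr_right_iff]
    intro hv
    rw [mem_fixedSpace] at hv
    have h3 : ∀ w, inner ℝ (φ w) v = 2 * inner ℝ w v := by
      intro w
      rw [hφ, inner_add_left, hP.symm, hv]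
      ring
    conv_rhs => rw [← T.orthogonal_orthogonal]
    simp only [Submodule.mem_orthogonal]
    constructor
    · intro h4 w hw
      have := h4 _ ⟨w, (T.mem_orthogonal w).2 hw, rfl⟩
      rw [h3] at this
      linarith
    · rintro h4 _ ⟨w, hw, rfl⟩
      rw [h3, h4 w ((T.mem_orthogonal w).1 hw), mul_zero]
  have h3 : Module.finrank ℝ (Tᗮ.map φ) = Module.finrank ℝ Tᗮ :=
    finrank_map_of_disjoint_ker hinj
  rw [h2, h3, hP.finrank_fixedSpace hl] at h1
  omega

/-- The space of the vectors normal to `T` in the tangent space of the sphere. -/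
theorem finrank_normal (h : IsFocalTangent P T x) :
    Module.finrank ℝ (Tᗮ ⊓ (ℝ ∙ x)ᗮ : Submodule ℝ V) + 1 = Module.finrank ℝ Tᗮ := by
  have hle : (ℝ ∙ x) ≤ Tᗮ := (Submodule.span_singleton_le_iff_mem _ _).2 h.base_mem
  have h1 := Submodule.finrank_add_inf_finrank_orthogonal hle
  have hx : x ≠ 0 := by
    rw [← norm_ne_zero_iff, h.unit]; exact one_ne_zero
  rw [finrank_span_singleton hx, inf_comm] at h1
  omega

/-- The normal part of Pn in the sphere is −fn, so adding fn leaves a tangent vector. These vectors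
will be the eigenvectors of the compression for f, that is, those of principal curvature 0. -/
theorem mem_levelTangent_of_normal (hP : IsBalancedInvolution P) (h : IsFocalTangent P T x) {n : V}
    (hn : n ∈ Tᗮ) (hnx : inner ℝ x n = 0) :
    P n + quadForm P x • n ∈ levelTangent P T x := by
  have h1 : inner ℝ (P x) n = 0 := by rw [h.inner_map_normal hn, hnx, mul_zero]
  rw [mem_levelTangent]
  constructor
  · rw [← T.orthogonal_orthogonal, Submodule.mem_orthogonal]
    intro w hw
    have h2 : w - inner ℝ x w • x ∈ Tᗮ := Tᗮ.sub_mem hw (Tᗮ.smul_mem _ h.base_mem)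
    have h3 : inner ℝ x (w - inner ℝ x w • x) = 0 := by
      rw [inner_sub_right, inner_smul_right, h.inner_self]; ring
    have h4 := h.normal n hn _ h2 hnx h3
    rw [inner_sub_right, inner_smul_right, inner_sub_right, inner_smul_right, hP.symm n x,
      real_inner_comm (P x) n, h1, real_inner_comm x n, hnx] at h4
    rw [inner_add_right, inner_smul_right, real_inner_comm (P n) w, real_inner_comm n w]
    linarith
  · rw [inner_add_right, inner_smul_right, h1, hP.inner_map_map, hnx]
    ring

/-- The defect of an eigenvector of the compression is a normal vector. -/
theorem defect_normal (hP : IsBalancedInvolution P) (h : IsFocalTangent P T x)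
    (hc : |quadForm P x| < 1) {μ : ℝ} {v : V}
    (hv : v ∈ compressionEigenspace P (levelTangent P T x) μ) :
    P v - μ • v ∈ Tᗮ ∧ inner ℝ x (P v - μ • v) = 0 := by
  obtain ⟨hv, hn⟩ := mem_compressionEigenspace.1 hv
  obtain ⟨hvT, hvx⟩ := mem_levelTangent.1 hv
  have h1 : inner ℝ x (P v - μ • v) = 0 := by
    rw [inner_sub_right, inner_smul_right, h.perp v hvT, ← hP.symm, hvx]
    ring
  have h2 : inner ℝ (P x) (P v - μ • v) = 0 := by
    rw [inner_sub_right, inner_smul_right, hP.inner_map_map, h.perp v hvT, hvx]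
    ring
  have h0 : 1 - quadForm P x ^ 2 ≠ 0 := by
    have := (sq_lt_one_iff_abs_lt_one _).2 hc
    linarith
  refine ⟨(T.mem_orthogonal _).2 fun t ht => ?_, h1⟩
  -- Since ⟨Px, Px − fx⟩ = 1 − f², this coefficient moves t into the tangent space of the level. The
  -- defect is orthogonal to x and Px, so the correction does not change its product with t.
  set a := inner ℝ (P x) t / (1 - quadForm P x ^ 2) with ha
  have h3 : t - a • (P x - quadForm P x • x) ∈ levelTangent P T x := by
    refine mem_levelTangent.2 ⟨T.sub_mem ht (T.smul_mem _ h.grad), ?_⟩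
    have h4 : inner ℝ (P x) x = quadForm P x := rfl
    rw [inner_sub_right, inner_smul_right, inner_sub_right, inner_smul_right, hP.inner_map_map, h4,
      h.inner_self, ha]
    field_simp
    ring
  have h5 := ((levelTangent P T x).mem_orthogonal _).1 hn _ h3
  rw [inner_sub_left, inner_smul_left, inner_sub_left, inner_smul_left, h1, h2] at h5
  simpa using h5

/-- With n = Pv − μv normal, P² = 1 gives v = μPv + Pn. Pairing with n and using ⟨v, n⟩ = 0, ⟨Pv, n⟩
= |n|² and ⟨Pn, n⟩ = −f|n|² leaves (μ − f)|n|² = 0. -/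
theorem eq_of_mem_compressionEigenspace (hP : IsBalancedInvolution P) (h : IsFocalTangent P T x)
    (hc : |quadForm P x| < 1) {μ : ℝ} {v : V}
    (hv : v ∈ compressionEigenspace P (levelTangent P T x) μ) :
    P v = μ • v ∨ μ = quadForm P x := by
  obtain ⟨h1, h2⟩ := h.defect_normal hP hc hv
  set n := P v - μ • v with hn
  have h3 : v = μ • P v + P n := by rw [hn, map_sub, map_smul, hP.sq]; abel
  have h4 := h.normal n h1 n h1 h2 h2
  have h5 : inner ℝ v n = 0 := (T.mem_orthogonal n).1 h1 v (mem_levelTangent.1 hv.1).1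
  have h6 : P v = μ • v + n := by rw [hn]; abel
  have h7 : (μ - quadForm P x) * inner ℝ n n = 0 := by
    have h8 := h5
    rw [h3, h6, inner_add_left, inner_smul_left, inner_add_left, inner_smul_left, h5, h4] at h8
    simp only [conj_trivial] at h8
    linarith
  rcases mul_eq_zero.1 h7 with h8 | h8
  · exact Or.inr (by linarith)
  · left
    rw [inner_self_eq_zero] at h8
    rw [h6, h8, add_zero]

theorem eigenvalue_compression (hP : IsBalancedInvolution P) (h : IsFocalTangent P T x)
    (hc : |quadForm P x| < 1) {μ : ℝ} {v : V} (hv0 : v ≠ 0)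
    (hv : v ∈ compressionEigenspace P (levelTangent P T x) μ) :
    μ = 1 ∨ μ = quadForm P x ∨ μ = -1 := by
  rcases h.eq_of_mem_compressionEigenspace hP hc hv with h1 | h1
  · have h2 : (μ * μ) • v = (1 : ℝ) • v := by
      rw [mul_smul, ← h1, ← map_smul, ← h1, hP.sq, one_smul]
    have h3 := smul_left_injective ℝ hv0 h2
    rcases mul_self_eq_one_iff.1 h3 with h4 | h4 <;> simp [h4]
  · exact Or.inr (Or.inl h1)

theorem compressionEigenspace_one (hP : IsBalancedInvolution P) (h : IsFocalTangent P T x)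
    (hc : |quadForm P x| < 1) :
    compressionEigenspace P (levelTangent P T x) 1 = fixedSpace P ⊓ T := by
  ext v
  constructor
  · intro hv
    refine ⟨?_, (mem_levelTangent.1 hv.1).1⟩
    rcases h.eq_of_mem_compressionEigenspace hP hc hv with h1 | h1
    · simpa using h1
    · rw [← h1, abs_one] at hc
      exact absurd hc (lt_irrefl _)
  · rintro ⟨hv, hvT⟩
    have hv' : P v = v := hv
    refine mem_compressionEigenspace.2 ⟨mem_levelTangent.2 ⟨hvT, ?_⟩, ?_⟩
    · rw [hP.symm, hv', h.perp v hvT]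
    · rw [hv', one_smul, sub_self]
      exact Submodule.zero_mem _

theorem finrank_compressionEigenspace_one (hP : IsBalancedInvolution P) (h : IsFocalTangent P T x)
    (hc : |quadForm P x| < 1) {l : ℕ} (hl : Module.finrank ℝ V = 2 * l) :
    Module.finrank ℝ (compressionEigenspace P (levelTangent P T x) 1) + Module.finrank ℝ Tᗮ = l := by
  rw [h.compressionEigenspace_one hP hc, h.finrank_fixedSpace_inf hP hc hl]

theorem compressionEigenspace_neg_one :
    compressionEigenspace P (levelTangent P T x) (-1) =
      compressionEigenspace (-P) (levelTangent (-P) T x) 1 := by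
  have h1 : levelTangent (-P) T x = levelTangent P T x := by
    ext v; simp [mem_levelTangent]
  rw [h1]
  ext v
  rw [mem_compressionEigenspace, mem_compressionEigenspace,
    ← Submodule.neg_mem_iff (p := (levelTangent P T x)ᗮ)]
  rw [show -(P v - (-1 : ℝ) • v) = (-P) v - (1 : ℝ) • v by rw [neg_apply]; module]

theorem finrank_compressionEigenspace_neg_one (hP : IsBalancedInvolution P)
    (h : IsFocalTangent P T x) (hc : |quadForm P x| < 1) {l : ℕ}
    (hl : Module.finrank ℝ V = 2 * l) :
    Module.finrank ℝ (compressionEigenspace P (levelTangent P T x) (-1)) +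
      Module.finrank ℝ Tᗮ = l := by
  rw [compressionEigenspace_neg_one]
  exact h.neg.finrank_compressionEigenspace_one hP.neg (by rwa [quadForm_neg, abs_neg]) hl

/-- The map n ↦ Pn + cn sends the normal space in the sphere isomorphically onto the eigenspace: the
defect of the image is (1 − c²)n, so n is recovered from it. -/
theorem finrank_compressionEigenspace_quadForm (hP : IsBalancedInvolution P)
    (h : IsFocalTangent P T x) (hc : |quadForm P x| < 1) :
    Module.finrank ℝ (compressionEigenspace P (levelTangent P T x) (quadForm P x)) + 1 =
      Module.finrank ℝ Tᗮ := by
  rw [← h.finrank_normal]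
  set c := quadForm P x with hcdef
  have h0 : 1 - c ^ 2 ≠ 0 := by
    have := (sq_lt_one_iff_abs_lt_one _).2 hc
    linarith
  let φ : V →ₗ[ℝ] V := P.toLinearMap + c • LinearMap.id
  have hφ : ∀ w, φ w = P w + c • w := fun _ => rfl
  have hmem : ∀ n : V, n ∈ (Tᗮ ⊓ (ℝ ∙ x)ᗮ : Submodule ℝ V) ↔ n ∈ Tᗮ ∧ inner ℝ x n = 0 := by
    intro n
    rw [Submodule.mem_inf, Submodule.mem_orthogonal_singleton_iff_inner_right]
  have hdef : ∀ n, P (φ n) - c • φ n = (1 - c ^ 2) • n := by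
    intro n
    rw [hφ, map_add, map_smul, hP.sq]
    module
  have hinj : Disjoint (Tᗮ ⊓ (ℝ ∙ x)ᗮ : Submodule ℝ V) (LinearMap.ker φ) := by
    rw [Submodule.disjoint_def]
    intro n _ hn0
    rw [LinearMap.mem_ker] at hn0
    have h1 := hdef n
    rw [hn0, map_zero, smul_zero, sub_zero] at h1
    exact (smul_eq_zero.1 h1.symm).resolve_left h0
  have h1 : compressionEigenspace P (levelTangent P T x) c = (Tᗮ ⊓ (ℝ ∙ x)ᗮ).map φ := by
    ext v
    constructor
    · intro hv
      obtain ⟨hn, hnx⟩ := h.defect_normal hP hc hv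
      refine ⟨(1 - c ^ 2)⁻¹ • (P v - c • v), Submodule.smul_mem _ _ ((hmem _).2 ⟨hn, hnx⟩), ?_⟩
      rw [map_smul, inv_smul_eq_iff₀ h0, hφ, map_sub, map_smul, hP.sq]
      module
    · rintro ⟨n, hn, rfl⟩
      obtain ⟨hn, hnx⟩ := (hmem n).1 hn
      refine mem_compressionEigenspace.2 ⟨h.mem_levelTangent_of_normal hP hn hnx, ?_⟩
      rw [hdef]
      exact Submodule.smul_mem _ _ (Submodule.orthogonal_le inf_le_left hn)
  rw [h1, finrank_map_of_disjoint_ker hinj]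

end IsFocalTangent

end FocalTangent

/-! ### Isoparametric functions and principal curvatures of focal pairs -/

section FocalPair

variable {V : Type*} [NormedAddCommGroup V] [InnerProductSpace ℝ V] [FiniteDimensional ℝ V]

theorem inner_eq_zero_of_mem_tangentSubspace {M : Set V} (hM : M ⊆ Metric.sphere 0 1) {x : V}
    (hx : x ∈ M) {v : V} (hv : v ∈ tangentSubspace M x) : inner ℝ x v = 0 := by
  have h1 : HasFDerivAt (fun y => quadForm (.id ℝ V) y - 1) (innerSL ℝ ((2 : ℝ) • x)) x :=
    (hasFDerivAt_quadForm (fun _ _ => rfl) x).sub_const 1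
  have h2 := tangentSubspace_le_ker hx h1
    (Eventually.of_forall fun y hy => by
      rw [quadForm_id, mem_sphere_zero_iff_norm.1 (hM hy)]; norm_num) hv
  simpa using h2

/-- A submanifold `M` of the unit sphere that contains the unit eigenvectors of the involution `P`,
and whose normal spaces in the sphere are adapted to `P`. -/
structure IsFocalPair (P : V →L[ℝ] V) (M : Set V) (d : ℕ) : Prop where
  involution : IsBalancedInvolution P
  closed : IsClosed M
  subset_sphere : M ⊆ Metric.sphere 0 1
  submanifold : IsEmbeddedSubmanifold M d
  tangent : ∀ x ∈ M, IsFocalTangent P (tangentSubspace M x) x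
  pos : ∀ x, ‖x‖ = 1 → P x = x → x ∈ M
  neg : ∀ x, ‖x‖ = 1 → P x = -x → x ∈ M
  join : ∀ u v, P u = u → P v = -v → u + v ∈ M →
    ∀ a b : ℝ, ‖a • u + b • v‖ = 1 → a • u + b • v ∈ M
  opposite : ∀ v, ‖v‖ = 1 → P v = -v →
    ∃ u, ‖u‖ = 1 ∧ P u = u ∧ (3 / 5 : ℝ) • u + (4 / 5 : ℝ) • v ∈ M

/-- The path is the segment from u + v to u, pushed radially to the sphere; it avoids 0 because its
component along u is constant. -/
theorem joinedIn_of_orthogonal {M : Set V} {u v : V} (huv : inner ℝ u v = 0) (hu : u ≠ 0)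
    (h1 : ‖u + v‖ = 1) (h : ∀ a b : ℝ, ‖a • u + b • v‖ = 1 → a • u + b • v ∈ M) :
    JoinedIn M (u + v) (‖u‖⁻¹ • u) := by
  have hne : ∀ t : ℝ, ‖u + (1 - t) • v‖ ≠ 0 := by
    intro t h0
    rw [norm_eq_zero] at h0
    have h2 : inner ℝ u (u + (1 - t) • v) = (0 : ℝ) := by rw [h0, inner_zero_right]
    rw [inner_add_right, inner_smul_right, huv, mul_zero, add_zero, inner_self_eq_zero] at h2
    exact hu h2
  refine JoinedIn.ofLine (f := fun t : ℝ => ‖u + (1 - t) • v‖⁻¹ • (u + (1 - t) • v)) ?_ ?_ ?_ ?_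
  · refine Continuous.continuousOn ?_
    exact (Continuous.inv₀ (by fun_prop) hne).smul (by fun_prop)
  · simp [h1]
  · simp
  · rintro _ ⟨t, -, rfl⟩
    have h2 := h ‖u + (1 - t) • v‖⁻¹ (‖u + (1 - t) • v‖⁻¹ * (1 - t))
    rw [mul_smul, ← smul_add] at h2
    refine h2 ?_
    rw [norm_smul, norm_inv, norm_norm, inv_mul_cancel₀ (hne t)]

namespace IsFocalPair

variable {P : V →L[ℝ] V} {M : Set V} {d l : ℕ}

theorem norm_eq_one (h : IsFocalPair P M d) {x : V} (hx : x ∈ M) : ‖x‖ = 1 :=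
  mem_sphere_zero_iff_norm.1 (h.subset_sphere hx)

theorem submanifoldGradient_eq (h : IsFocalPair P M d) {x : V} (hx : x ∈ M) :
    submanifoldGradient M (quadForm P) x = (2 : ℝ) • (P x - quadForm P x • x) := by
  rw [_root_.submanifoldGradient_eq hx (hasFDerivAt_quadForm h.involution.symm x)]
  refine starProjection_eq_of_mem (Submodule.smul_mem _ _ (h.tangent x hx).grad) fun v hv => ?_
  rw [← smul_sub, sub_sub_cancel, inner_smul_right, inner_smul_right, real_inner_comm,
    (h.tangent x hx).perp v hv]
  ring

theorem norm_submanifoldGradient_sq (h : IsFocalPair P M d) {x : V} (hx : x ∈ M) :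
    ‖submanifoldGradient M (quadForm P) x‖ ^ 2 = 4 * (1 - quadForm P x ^ 2) := by
  rw [h.submanifoldGradient_eq hx, norm_smul, mul_pow, norm_sub_sq_real, h.involution.norm_map,
    norm_smul, h.norm_eq_one hx, inner_smul_right]
  have h1 : inner ℝ (P x) x = quadForm P x := rfl
  rw [h1]
  simp only [Real.norm_eq_abs, mul_one, sq_abs]
  ring

theorem submanifoldLaplacian_eq (h : IsFocalPair P M d) (hl : Module.finrank ℝ V = 2 * l) {x : V}
    (hx : x ∈ M) :
    submanifoldLaplacian M (quadForm P) x = -4 * ((d : ℝ) + 1 - l) * quadForm P x := by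
  set T := tangentSubspace M x with hT
  have hf := hasFDerivAt_quadForm h.involution.symm x
  -- The ambient derivative of 2(Py − f(y)y). Its term in the direction x drops out of the trace, as
  -- x is orthogonal to the tangent space.
  let L : V →L[ℝ] V := (2 : ℝ) • (P - (quadForm P x • ContinuousLinearMap.id ℝ V +
    (innerSL ℝ ((2 : ℝ) • P x)).smulRight x))
  have hL : HasFDerivAt (fun y => (2 : ℝ) • (P y - quadForm P y • y)) L x :=
    ((P.hasFDerivAt.sub (hf.smul (hasFDerivAt_id x))).const_smul (2 : ℝ))
  have h1 : covariantDifferential M (submanifoldGradient M (quadForm P)) x =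
      (T.orthogonalProjectionOnto ∘L L ∘L T.subtypeL : T →L[ℝ] T).toLinearMap := by
    ext v
    rw [covariantDifferential_apply hx hL fun y hy => h.submanifoldGradient_eq hy]
    rfl
  rw [submanifoldLaplacian, h1, trace_compression]
  have h2 : ∀ a, inner ℝ (L (stdOrthonormalBasis ℝ T a : V)) (stdOrthonormalBasis ℝ T a : V) =
      2 * inner ℝ (P (stdOrthonormalBasis ℝ T a : V)) (stdOrthonormalBasis ℝ T a : V) -
        2 * quadForm P x := by
    intro a
    have h3 : inner ℝ (stdOrthonormalBasis ℝ T a : V) (stdOrthonormalBasis ℝ T a : V) = (1 : ℝ) := by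
      rw [real_inner_self_eq_norm_sq, Submodule.norm_coe, OrthonormalBasis.norm_eq_one, one_pow]
    have h4 := (h.tangent x hx).perp _ (stdOrthonormalBasis ℝ T a).2
    have h5 : ∀ v, L v = (2 : ℝ) • (P v - (quadForm P x • v + inner ℝ ((2 : ℝ) • P x) v • x)) :=
      fun _ => rfl
    rw [h5, inner_smul_left, inner_sub_left, inner_add_left, inner_smul_left, inner_smul_left x,
      h3, h4]
    simp
    ring
  have h6 : Module.finrank ℝ T = d := h.submanifold.finrank_tangentSubspace hx
  have h7 := T.finrank_add_finrank_orthogonal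
  rw [Finset.sum_congr rfl fun a _ => h2 a, Finset.sum_sub_distrib, ← Finset.mul_sum,
    (h.tangent x hx).trace_compression h.involution]
  have h8 : (Module.finrank ℝ Tᗮ : ℝ) = 2 * l - d := by
    rw [h6, hl] at h7
    have : ((d + Module.finrank ℝ Tᗮ : ℕ) : ℝ) = ((2 * l : ℕ) : ℝ) := by rw [h7]
    push_cast at this
    linarith
  rw [h8]
  simp only [Finset.sum_const, Finset.card_univ, Fintype.card_fin, nsmul_eq_mul, h6]
  ring

theorem isPathConnected_unit_fixedSpace {P : V →L[ℝ] V} (h : IsBalancedInvolution P)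
    (hl : Module.finrank ℝ V = 2 * l) (hl2 : 2 ≤ l) :
    IsPathConnected {x : V | ‖x‖ = 1 ∧ P x = x} := by
  have hrank : 1 < Module.rank ℝ (fixedSpace P) := by
    rw [← Module.finrank_eq_rank, h.finrank_fixedSpace hl]
    exact_mod_cast hl2
  have h1 := (isPathConnected_sphere hrank (0 : fixedSpace P) zero_le_one).image
    (f := ((↑) : fixedSpace P → V)) continuous_subtype_val
  convert h1 using 1
  ext x
  constructor
  · rintro ⟨hx, hPx⟩
    exact ⟨⟨x, hPx⟩, by rw [mem_sphere_zero_iff_norm]; exact hx, rfl⟩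
  · rintro ⟨y, hy, rfl⟩
    exact ⟨by rw [mem_sphere_zero_iff_norm] at hy; exact hy, y.2⟩

/-- Splitting a point into its eigencomponents u + v, the closure property `join` lets it slide
inside M to the unit sphere of the fixed space, which is path connected for l ≥ 2. -/
theorem isConnected (h : IsFocalPair P M d) (hl : Module.finrank ℝ V = 2 * l) (hl2 : 2 ≤ l) :
    IsConnected M := by
  have hc := isPathConnected_unit_fixedSpace h.involution hl hl2
  obtain ⟨p, hp, hpj⟩ := hc
  have hsub : {x : V | ‖x‖ = 1 ∧ P x = x} ⊆ M := fun x hx => h.pos x hx.1 hx.2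
  refine IsPathConnected.isConnected ⟨p, hsub hp, fun {y} hy => ?_⟩
  have key : ∀ u v, P u = u → P v = -v → u ≠ 0 → u + v ∈ M → JoinedIn M (u + v) p := by
    intro u v hu hv hu0 huv
    refine (joinedIn_of_orthogonal (h.involution.inner_eq_zero hu hv) hu0 (h.norm_eq_one huv)
      (h.join u v hu hv huv)).trans ((hpj ⟨?_, ?_⟩).symm.mono hsub)
    · rw [norm_smul, norm_inv, norm_norm, inv_mul_cancel₀ (norm_ne_zero_iff.2 hu0)]
    · rw [map_smul, hu]
  have hu : P ((1 / 2 : ℝ) • (y + P y)) = (1 / 2 : ℝ) • (y + P y) := by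
    rw [map_smul, map_add, h.involution.sq, add_comm]
  have hv : P ((1 / 2 : ℝ) • (y - P y)) = -((1 / 2 : ℝ) • (y - P y)) := by
    rw [map_smul, map_sub, h.involution.sq, ← smul_neg, neg_sub]
  have huv : (1 / 2 : ℝ) • (y + P y) + (1 / 2 : ℝ) • (y - P y) = y := by module
  -- A point of the (−1)-eigenspace has no fixed component to slide to; `opposite` first connects it
  -- to a point of M with both components nonzero. The coefficients 3/5 and 4/5 merely give a
  -- rational unit combination.
  by_cases hu0 : (1 / 2 : ℝ) • (y + P y) = 0
  · have hPy : P y = -y := by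
      rw [smul_eq_zero] at hu0
      exact eq_neg_of_add_eq_zero_right (hu0.resolve_left (by norm_num))
    obtain ⟨u, hu1, hPu, hmem⟩ := h.opposite y (h.norm_eq_one hy) hPy
    have hPu' : P ((3 / 5 : ℝ) • u) = (3 / 5 : ℝ) • u := by rw [map_smul, hPu]
    have hPy' : P ((4 / 5 : ℝ) • y) = -((4 / 5 : ℝ) • y) := by rw [map_smul, hPy, smul_neg]
    have hu0' : (3 / 5 : ℝ) • u ≠ 0 := smul_ne_zero (by norm_num) (norm_ne_zero_iff.1 (by simp [hu1]))
    have hy0' : (4 / 5 : ℝ) • y ≠ 0 :=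
      smul_ne_zero (by norm_num) (norm_ne_zero_iff.1 (by simp [h.norm_eq_one hy]))
    have h1 := joinedIn_of_orthogonal (M := M) (u := (4 / 5 : ℝ) • y) (v := (3 / 5 : ℝ) • u)
      (by rw [real_inner_comm]; exact h.involution.inner_eq_zero hPu' hPy') hy0'
      (by rw [add_comm]; exact h.norm_eq_one hmem)
      (fun a b hab => by
        rw [add_comm] at hab ⊢
        exact h.join _ _ hPu' hPy' hmem b a hab)
    have h2 : ‖(4 / 5 : ℝ) • y‖⁻¹ • (4 / 5 : ℝ) • y = y := by
      rw [norm_smul, h.norm_eq_one hy, smul_smul]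
      norm_num
    rw [h2, add_comm] at h1
    exact ((h1.symm.trans (key _ _ hPu' hPy' hu0' hmem)).symm)
  · have h1 := key _ _ hu hv hu0 (by rwa [huv])
    rw [huv] at h1
    exact h1.symm

theorem exists_unit_fixed {P : V →L[ℝ] V} (h : IsBalancedInvolution P)
    (hl : Module.finrank ℝ V = 2 * l) (hl2 : 2 ≤ l) : ∃ x, ‖x‖ = 1 ∧ P x = x :=
  (isPathConnected_unit_fixedSpace h hl hl2).nonempty

theorem exists_quadForm_eq_one (h : IsFocalPair P M d) (hl : Module.finrank ℝ V = 2 * l)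
    (hl2 : 2 ≤ l) : ∃ x ∈ M, quadForm P x = 1 := by
  obtain ⟨x, hx, hPx⟩ := exists_unit_fixed h.involution hl hl2
  exact ⟨x, h.pos x hx hPx, (h.involution.quadForm_eq_one_iff hx).2 hPx⟩

theorem exists_quadForm_eq_neg_one (h : IsFocalPair P M d) (hl : Module.finrank ℝ V = 2 * l)
    (hl2 : 2 ≤ l) : ∃ x ∈ M, quadForm P x = -1 := by
  obtain ⟨x, hx, hPx⟩ := exists_unit_fixed h.involution.neg hl hl2
  have h1 := (h.involution.neg.quadForm_eq_one_iff hx).2 hPx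
  rw [quadForm_neg] at h1
  rw [neg_apply, neg_eq_iff_eq_neg] at hPx
  exact ⟨x, h.neg x hx hPx, by linarith⟩

theorem image_quadForm (h : IsFocalPair P M d) (hl : Module.finrank ℝ V = 2 * l) (hl2 : 2 ≤ l) :
    quadForm P '' M = Icc (-1) 1 := by
  apply Subset.antisymm
  · rintro _ ⟨x, hx, rfl⟩
    exact h.involution.quadForm_mem_Icc (h.norm_eq_one hx)
  · obtain ⟨x, hx, hx1⟩ := h.exists_quadForm_eq_one hl hl2
    obtain ⟨y, hy, hy1⟩ := h.exists_quadForm_eq_neg_one hl hl2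
    have := (h.isConnected hl hl2).isPreconnected.intermediate_value hy hx
      (contDiff_quadForm P).continuous.continuousOn
    rwa [hx1, hy1] at this

theorem isIsoparametricFunction (h : IsFocalPair P M d) (hl : Module.finrank ℝ V = 2 * l)
    (hl2 : 2 ≤ l) : IsIsoparametricFunction M (quadForm P) where
  submanifold := ⟨d, h.submanifold⟩
  connected := h.isConnected hl hl2
  complete := h.closed.isComplete
  smooth := (contDiff_quadForm P).contDiffOn
  nonconstant := by
    obtain ⟨x, hx, hx1⟩ := h.exists_quadForm_eq_one hl hl2
    obtain ⟨y, hy, hy1⟩ := h.exists_quadForm_eq_neg_one hl hl2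
    exact ⟨x, hx, y, hy, by rw [hx1, hy1]; norm_num⟩
  transnormal := ⟨fun t => 4 * (1 - t ^ 2), by fun_prop, fun x hx => h.norm_submanifoldGradient_sq hx⟩
  laplacian := ⟨fun t => -4 * ((d : ℝ) + 1 - l) * t, fun x hx => h.submanifoldLaplacian_eq hl hx⟩

theorem isIsoparametricHypersurface (h : IsFocalPair P M d) (hl : Module.finrank ℝ V = 2 * l)
    (hl2 : 2 ≤ l) : IsIsoparametricHypersurface (levelSet M (quadForm P) 0) M := by
  refine ⟨quadForm P, 0, h.isIsoparametricFunction hl hl2, rfl, ?_, ?_⟩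
  · have h0 : (0 : ℝ) ∈ quadForm P '' M := by
      rw [h.image_quadForm hl hl2]; constructor <;> norm_num
    obtain ⟨x, hx, hx0⟩ := h0
    exact ⟨x, hx, hx0⟩
  · rintro x ⟨hx, hx0⟩ h0
    have h1 := h.norm_submanifoldGradient_sq hx
    rw [h0, hx0] at h1
    norm_num at h1

theorem exists_fderiv_ne_zero (h : IsFocalPair P M d) {x : V} (hx : x ∈ M)
    (hc : |quadForm P x| < 1) : ∃ v ∈ tangentSubspace M x, fderiv ℝ (quadForm P) x v ≠ 0 := by
  refine ⟨_, (h.tangent x hx).grad, ?_⟩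
  have h1 : inner ℝ (P x) x = quadForm P x := rfl
  have h2 := (sq_lt_one_iff_abs_lt_one _).2 hc
  rw [fderiv_quadForm h.involution.symm, inner_sub_right, inner_smul_right, h1,
    h.involution.inner_map_map, (h.tangent x hx).inner_self]
  intro h3
  nlinarith

theorem isEmbeddedSubmanifold_levelSet (h : IsFocalPair P M d) (hd : 1 ≤ d) {c : ℝ}
    (hc : c ∈ Ioo (-1 : ℝ) 1) : IsEmbeddedSubmanifold (levelSet M (quadForm P) c) (d - 1) := by
  refine _root_.isEmbeddedSubmanifold_levelSet (by rw [Nat.sub_add_cancel hd]; exact h.submanifold)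
    (contDiff_quadForm P) ?_
  rintro x ⟨hx, rfl⟩
  exact h.exists_fderiv_ne_zero hx (abs_lt.2 hc)

theorem tangentSubspace_levelSet (h : IsFocalPair P M d) {c : ℝ} (hc : c ∈ Ioo (-1 : ℝ) 1) {x : V}
    (hx : x ∈ levelSet M (quadForm P) c) :
    tangentSubspace (levelSet M (quadForm P) c) x = levelTangent P (tangentSubspace M x) x := by
  rw [h.submanifold.tangentSubspace_levelSet (contDiff_quadForm P) hx
    (h.exists_fderiv_ne_zero hx.1 (by rw [hx.2]; exact abs_lt.2 hc))]
  ext v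
  rw [mem_levelTangent, Submodule.mem_inf, LinearMap.mem_ker, ContinuousLinearMap.coe_coe,
    fderiv_quadForm h.involution.symm]
  simp

theorem levelUnitNormal_eq (h : IsFocalPair P M d) {c : ℝ} (hc : c ∈ Ioo (-1 : ℝ) 1) {x : V}
    (hx : x ∈ levelSet M (quadForm P) c) :
    levelUnitNormal M (quadForm P) x = (√(1 - c ^ 2))⁻¹ • (P x - c • x) := by
  have h1 := h.norm_submanifoldGradient_sq hx.1
  have hc2 : 0 < 1 - c ^ 2 := by nlinarith [hc.1, hc.2]
  have h2 : ‖submanifoldGradient M (quadForm P) x‖ = 2 * √(1 - c ^ 2) := by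
    rw [← sq_eq_sq₀ (norm_nonneg _) (by positivity), h1, mul_pow, Real.sq_sqrt hc2.le, hx.2]
    norm_num
  have h3 : √(1 - c ^ 2) ≠ 0 := (Real.sqrt_pos.2 hc2).ne'
  rw [levelUnitNormal, h2, h.submanifoldGradient_eq hx.1, hx.2, smul_smul]
  congr 1
  field_simp

/-- Along the level the unit normal agrees with the linear map (P − c)/s, where s = √(1 − c²). So
the shape operator is the compression of (c − P)/s, and κ corresponds to μ = c − sκ. -/
theorem map_eigenspace_shapeOperator (h : IsFocalPair P M d) {c : ℝ} (hc : c ∈ Ioo (-1 : ℝ) 1)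
    {x : V} (hx : x ∈ levelSet M (quadForm P) c) (κ : ℝ) :
    (Module.End.eigenspace (shapeOperator (levelSet M (quadForm P) c)
      (levelUnitNormal M (quadForm P)) x) κ).map (Submodule.subtype _) =
    compressionEigenspace P (levelTangent P (tangentSubspace M x) x) (c - √(1 - c ^ 2) * κ) := by
  rw [← h.tangentSubspace_levelSet hc hx]
  have hc2 : 0 < 1 - c ^ 2 := by nlinarith [hc.1, hc.2]
  have hs : √(1 - c ^ 2) ≠ 0 := (Real.sqrt_pos.2 hc2).ne'
  set s := √(1 - c ^ 2)
  set K := tangentSubspace (levelSet M (quadForm P) c) x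
  have hG : HasFDerivAt (fun y => s⁻¹ • (P y - c • y)) (s⁻¹ • (P - c • ContinuousLinearMap.id ℝ V)) x :=
    ((P.hasFDerivAt.sub ((hasFDerivAt_id x).const_smul c)).const_smul s⁻¹)
  have h1 : ∀ v : K, shapeOperator (levelSet M (quadForm P) c)
      (levelUnitNormal M (quadForm P)) x v =
        -K.orthogonalProjectionOnto (s⁻¹ • (P v - c • (v : V))) := by
    intro v
    rw [shapeOperator, LinearMap.neg_apply,
      covariantDifferential_apply hx hG fun y hy => h.levelUnitNormal_eq hc hy]
    rfl
  have h2 : ∀ v : K, v ∈ Module.End.eigenspace (shapeOperator (levelSet M (quadForm P) c)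
      (levelUnitNormal M (quadForm P)) x) κ ↔ P v - (c - s * κ) • (v : V) ∈ Kᗮ := by
    intro v
    have h3 : P v - (c - s * κ) • (v : V) = (P v - c • (v : V)) + (s * κ) • (v : V) := by module
    rw [Module.End.mem_eigenspace_iff, h1, ← Submodule.orthogonalProjectionOnto_eq_zero_iff, h3,
      map_add, map_smul, map_smul, Submodule.orthogonalProjectionOnto_mem_subspace_eq_self,
      neg_eq_iff_eq_neg, inv_smul_eq_iff₀ hs, eq_comm, smul_neg, smul_smul, eq_comm,
      eq_neg_iff_add_eq_zero]
  ext v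
  rw [mem_compressionEigenspace]
  constructor
  · rintro ⟨w, hw, rfl⟩
    exact ⟨w.2, (h2 w).1 hw⟩
  · rintro ⟨hv, hv'⟩
    exact ⟨⟨v, hv⟩, (h2 ⟨v, hv⟩).2 hv', rfl⟩

theorem principalMultiplicity_eq (h : IsFocalPair P M d) {c : ℝ} (hc : c ∈ Ioo (-1 : ℝ) 1)
    {x : V} (hx : x ∈ levelSet M (quadForm P) c) (κ : ℝ) :
    principalMultiplicity (levelSet M (quadForm P) c) (levelUnitNormal M (quadForm P)) x κ =
    Module.finrank ℝ (compressionEigenspace P (levelTangent P (tangentSubspace M x) x)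
      (c - √(1 - c ^ 2) * κ)) := by
  rw [← h.map_eigenspace_shapeOperator hc hx, principalMultiplicity,
    Submodule.finrank_map_subtype_eq]

end IsFocalPair

theorem sqrt_mul_sqrt_div {a b : ℝ} (ha : 0 < a) (hb : 0 < b) : √(a * b) * √(a / b) = a := by
  rw [← Real.sqrt_mul (by positivity), show a * b * (a / b) = a ^ 2 by field_simp,
    Real.sqrt_sq ha.le]

namespace IsFocalPair

variable {P : V →L[ℝ] V} {M : Set V} {d l : ℕ}

theorem principalCurvatures (h : IsFocalPair P M d) (hl : Module.finrank ℝ V = 2 * l)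
    {c : ℝ} (hc : c ∈ Ioo (-1 : ℝ) 1) {x : V} (hx : x ∈ levelSet M (quadForm P) c) :
    (∀ κ : ℝ, (shapeOperator (levelSet M (quadForm P) c) (levelUnitNormal M (quadForm P))
        x).HasEigenvalue κ → κ = -√((1 - c) / (1 + c)) ∨ κ = 0 ∨ κ = √((1 + c) / (1 - c))) ∧
    principalMultiplicity (levelSet M (quadForm P) c) (levelUnitNormal M (quadForm P)) x
        (-√((1 - c) / (1 + c))) = d - l ∧
    principalMultiplicity (levelSet M (quadForm P) c) (levelUnitNormal M (quadForm P)) x 0 =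
        2 * l - d - 1 ∧
    principalMultiplicity (levelSet M (quadForm P) c) (levelUnitNormal M (quadForm P)) x
        (√((1 + c) / (1 - c))) = d - l := by
  have hxc : |quadForm P x| < 1 := by rw [hx.2]; exact abs_lt.2 hc
  have hT := h.tangent x hx.1
  have hp : 0 < 1 + c := by linarith [hc.1]
  have hn : 0 < 1 - c := by linarith [hc.2]
  have hs : √(1 - c ^ 2) ≠ 0 := (Real.sqrt_pos.2 (by nlinarith)).ne'
  have e1 : √(1 - c ^ 2) * √((1 - c) / (1 + c)) = 1 - c := by
    rw [show 1 - c ^ 2 = (1 - c) * (1 + c) by ring, sqrt_mul_sqrt_div hn hp]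
  have e2 : √(1 - c ^ 2) * √((1 + c) / (1 - c)) = 1 + c := by
    rw [show 1 - c ^ 2 = (1 + c) * (1 - c) by ring, sqrt_mul_sqrt_div hp hn]
  have hd := h.submanifold.finrank_tangentSubspace hx.1
  have hd' := (tangentSubspace M x).finrank_add_finrank_orthogonal
  refine ⟨fun κ hκ => ?_, ?_, ?_, ?_⟩
  · obtain ⟨v, hv, hv0⟩ := hκ.exists_hasEigenvector
    have h1 := (h.map_eigenspace_shapeOperator hc hx κ).le ⟨v, hv, rfl⟩
    have hv0' : (Submodule.subtype _ v : V) ≠ 0 := fun h0 => hv0 (Subtype.ext h0)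
    rcases hT.eigenvalue_compression h.involution hxc hv0' h1 with h2 | h2 | h2
    · left
      apply mul_left_cancel₀ hs
      linarith
    · right; left
      rw [hx.2] at h2
      apply mul_left_cancel₀ hs
      linarith
    · right; right
      apply mul_left_cancel₀ hs
      linarith
  -- The curvatures in the order of the statement correspond to μ = 1, c, −1. The natural
  -- subtractions are exact: the codimension of the tangent space is 2l − d, and adding it to the
  -- eigenspace dimension gives l for μ = ±1, while for μ = c it is one more than that dimension.
  · rw [h.principalMultiplicity_eq hc hx, mul_neg, e1, show c - -(1 - c) = 1 by ring]
    have := hT.finrank_compressionEigenspace_one h.involution hxc hl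
    omega
  · rw [h.principalMultiplicity_eq hc hx, mul_zero, sub_zero]
    have := hT.finrank_compressionEigenspace_quadForm h.involution hxc
    rw [hx.2] at this
    omega
  · rw [h.principalMultiplicity_eq hc hx, e2, show c - (1 + c) = -1 by ring]
    have := hT.finrank_compressionEigenspace_neg_one h.involution hxc hl
    omega

end IsFocalPair

end FocalPair

/-! ### The focal submanifolds as unit spheres of eigenspaces -/

section FocalSubmanifold

variable {V : Type*} [NormedAddCommGroup V] [InnerProductSpace ℝ V] [FiniteDimensional ℝ V]

/-- The unit sphere of the space of the fixed vectors of `P`. -/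
def fixedSphere (P : V →L[ℝ] V) : Set V := levelSet {x | P x = x} (quadForm (.id ℝ V)) 1

theorem mem_fixedSphere {P : V →L[ℝ] V} {x : V} : x ∈ fixedSphere P ↔ P x = x ∧ ‖x‖ = 1 := by
  simp only [fixedSphere, levelSet, mem_ofPred_eq, quadForm_id, and_congr_right_iff]
  intro _
  exact pow_eq_one_iff_of_nonneg (norm_nonneg x) two_ne_zero

/-- The projection to the vectors `v` with `P v = -v`, if `P` is an involution. -/
def antiProjection (P : V →L[ℝ] V) : V →L[ℝ] V := (1 / 2 : ℝ) • (ContinuousLinearMap.id ℝ V - P)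

theorem antiProjection_apply (P : V →L[ℝ] V) (v : V) :
    antiProjection P v = (1 / 2 : ℝ) • (v - P v) := rfl

theorem antiProjection_eq_zero {P : V →L[ℝ] V} {v : V} : antiProjection P v = 0 ↔ P v = v := by
  rw [antiProjection_apply, smul_eq_zero_iff_right (by norm_num), sub_eq_zero, eq_comm]

theorem ker_antiProjection {P : V →L[ℝ] V} :
    LinearMap.ker (antiProjection P).toLinearMap = fixedSpace P := by
  ext v
  exact antiProjection_eq_zero

namespace IsBalancedInvolution

variable {P : V →L[ℝ] V} {l : ℕ}

theorem antiProjection_antiProjection (h : IsBalancedInvolution P) (v : V) :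
    antiProjection P (antiProjection P v) = antiProjection P v := by
  simp only [antiProjection_apply, map_smul, map_sub, h.sq]
  module

theorem definesNear_fixedSpace (h : IsBalancedInvolution P) {x : V} :
    DefinesNear {x | P x = x} (fun y => 
      (antiProjection P).toLinearMap.rangeRestrict (antiProjection P y)) x := by
  refine definesNear_of_projection (B := fun _ => antiProjection P) isOpen_univ (mem_univ x)
    (antiProjection P).contDiff.contDiffOn ?_ continuousAt_const rfl
    (fun y _ => h.antiProjection_antiProjection y) (antiProjection P).hasFDerivAt
    (by ext y; exact h.antiProjection_antiProjection y)
  ext y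
  simp [antiProjection_eq_zero]

theorem fderiv_quadForm_id_ne_zero {x : V} (hx : x ∈ fixedSphere P) :
    fderiv ℝ (quadForm (.id ℝ V)) x x ≠ 0 := by
  rw [fderiv_quadForm (fun _ _ => rfl)]
  simp [(mem_fixedSphere.1 hx).2]

theorem fderiv_fixed (h : IsBalancedInvolution P) {x : V} :
    (fderiv ℝ (fun y => 
      (antiProjection P).toLinearMap.rangeRestrict (antiProjection P y)) x).ker = fixedSpace P := by
  rw [fderiv_rangeRestrict_comp (antiProjection P).hasFDerivAt]
  · exact ker_antiProjection
  · ext y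
    exact h.antiProjection_antiProjection y

theorem isEmbeddedSubmanifold_fixedSphere (h : IsBalancedInvolution P)
    (hl : Module.finrank ℝ V = 2 * l) (hl1 : 1 ≤ l) :
    IsEmbeddedSubmanifold (fixedSphere P) (l - 1) := by
  refine isEmbeddedSubmanifold_of_definesNear (fun x hx => h.definesNear_fixedSpace.levelSet
    (contDiff_quadForm _) 1 (v := x) ?_ (fderiv_quadForm_id_ne_zero hx)) fun _ => ?_
  · have : x ∈ fixedSpace P := (mem_fixedSphere.1 hx).1
    rw [← h.fderiv_fixed (x := x)] at this
    exact this
  · have h1 := LinearMap.finrank_range_add_finrank_ker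
      (antiProjection P).toLinearMap
    rw [ker_antiProjection, h.finrank_fixedSpace hl] at h1
    rw [Module.finrank_prod, Module.finrank_self]
    omega

theorem mem_tangentSubspace_fixedSphere (h : IsBalancedInvolution P) {x : V}
    (hx : x ∈ fixedSphere P) {v : V} :
    v ∈ tangentSubspace (fixedSphere P) x ↔ P v = v ∧ inner ℝ x v = 0 := by
  have h0 : x ∈ fixedSpace P := (mem_fixedSphere.1 hx).1
  rw [← h.fderiv_fixed (x := x)] at h0
  rw [fixedSphere, (h.definesNear_fixedSpace (x := x)).tangentSubspace_levelSet
    (contDiff_quadForm _) h0 (fderiv_quadForm_id_ne_zero hx) hx,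
    h.definesNear_fixedSpace.tangentSubspace_eq hx.1, h.fderiv_fixed, Submodule.mem_inf,
    LinearMap.mem_ker, ContinuousLinearMap.coe_coe, fderiv_quadForm (fun _ _ => rfl)]
  simp

theorem starProjection_fixedSphere (h : IsBalancedInvolution P) {x : V}
    (hx : x ∈ fixedSphere P) (w : V) :
    (tangentSubspace (fixedSphere P) x).starProjection w =
      (1 / 2 : ℝ) • (w + P w) - inner ℝ x w • x := by
  obtain ⟨hPx, hx1⟩ := mem_fixedSphere.1 hx
  have h2 : inner ℝ x (P w) = inner ℝ x w := by rw [← h.symm, hPx]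
  refine starProjection_eq_of_mem ((h.mem_tangentSubspace_fixedSphere hx).2 ⟨?_, ?_⟩) fun v hv => ?_
  · rw [map_sub, map_smul, map_smul, map_add, h.sq, hPx, add_comm]
  · rw [inner_sub_right, inner_smul_right, inner_smul_right, inner_add_right, h2,
      real_inner_self_eq_norm_sq, hx1]
    ring
  · obtain ⟨hPv, hv⟩ := (h.mem_tangentSubspace_fixedSphere hx).1 hv
    have h3 : inner ℝ v (P w) = inner ℝ v w := by rw [← h.symm, hPv]
    rw [inner_sub_right, inner_sub_right, inner_smul_right, inner_smul_right, inner_add_right, h3,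
      real_inner_comm x v, hv]
    ring

/-- The projected extension of Y differentiates along X to −⟨Y, X⟩x. This is radial, hence normal to
every submanifold of the unit sphere, so both projections vanish. -/
theorem isTotallyGeodesic_fixedSphere (h : IsBalancedInvolution P) {M : Set V} {d : ℕ}
    (hl : Module.finrank ℝ V = 2 * l) (hl1 : 1 ≤ l) (hM : IsEmbeddedSubmanifold M d)
    (hMs : M ⊆ Metric.sphere 0 1) (hsub : fixedSphere P ⊆ M) :
    IsTotallyGeodesicSubmanifold (fixedSphere P) M where
  ambient := ⟨d, hM⟩
  submanifold := ⟨_, h.isEmbeddedSubmanifold_fixedSphere hl hl1⟩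
  subset := hsub
  secondFundamental x hx X hX Y hY := by
    have hD : HasFDerivAt (fun y => (1 / 2 : ℝ) • (Y + P Y) - inner ℝ y Y • y)
        (-(inner ℝ x Y • ContinuousLinearMap.id ℝ V + (innerSL ℝ Y).smulRight x)) x := by
      have h1 : HasFDerivAt (fun y : V => inner ℝ y Y) (innerSL ℝ Y) x := by
        have := (innerSL ℝ Y).hasFDerivAt (x := x)
        refine this.congr_of_eventuallyEq (Eventually.of_forall fun y => ?_)
        exact real_inner_comm Y y
      exact (h1.smul (hasFDerivAt_id x)).const_sub _
    have h2 : (-(inner ℝ x Y • ContinuousLinearMap.id ℝ V + (innerSL ℝ Y).smulRight x)) X =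
        -(inner ℝ Y X • x) := by
      simp [((h.mem_tangentSubspace_fixedSphere hx).1 hY).2]
    have h3 : ∀ S : Set V, x ∈ S → S ⊆ Metric.sphere 0 1 →
        (tangentSubspace S x).starProjection (-(inner ℝ Y X • x)) = 0 := by
      intro S hxS hS
      rw [map_neg, map_smul, (Submodule.starProjection_apply_eq_zero_iff _).2, smul_zero, neg_zero]
      exact ((tangentSubspace S x).mem_orthogonal' x).2
        fun v hv => inner_eq_zero_of_mem_tangentSubspace hS hxS hv
    rw [secondFundamentalForm_eq hx hX hD fun y hy => h.starProjection_fixedSphere hy Y, h2,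
      h3 M (hsub hx) hMs, h3 _ hx (hsub.trans hMs), sub_zero]

/-- The isometry is the restriction of a linear one: orthonormal coordinates on the fixed space,
extended to the ambient space by the orthogonal projection. -/
theorem isometric_fixedSphere (h : IsBalancedInvolution P) (hl : Module.finrank ℝ V = 2 * l) :
    AreRiemannianIsometric (fixedSphere P) (Metric.sphere (0 : EuclideanSpace ℝ (Fin l)) 1) := by
  let e : fixedSpace P ≃ₗᵢ[ℝ] EuclideanSpace ℝ (Fin l) :=
    ((stdOrthonormalBasis ℝ (fixedSpace P)).reindex (finCongr (h.finrank_fixedSpace hl))).repr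
  let F : V →L[ℝ] EuclideanSpace ℝ (Fin l) :=
    (e.toContinuousLinearEquiv : fixedSpace P →L[ℝ] EuclideanSpace ℝ (Fin l)) ∘L
      (fixedSpace P).orthogonalProjectionOnto
  let G : EuclideanSpace ℝ (Fin l) →L[ℝ] V := (fixedSpace P).subtypeL ∘L
    (e.symm.toContinuousLinearEquiv : EuclideanSpace ℝ (Fin l) →L[ℝ] fixedSpace P)
  have hF : ∀ v (hv : P v = v), F v = e ⟨v, hv⟩ := fun v hv => by
    have : (fixedSpace P).orthogonalProjectionOnto v = ⟨v, hv⟩ :=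
      Submodule.orthogonalProjectionOnto_mem_subspace_eq_self (⟨v, hv⟩ : fixedSpace P)
    change e ((fixedSpace P).orthogonalProjectionOnto v) = _
    rw [this]
  have hG : ∀ w, G w = (e.symm w : V) := fun _ => rfl
  have hPG : ∀ w, P (G w) = G w := fun w => (e.symm w).2
  have hFn : ∀ v, P v = v → ‖F v‖ = ‖v‖ := fun v hv => by rw [hF v hv, e.norm_map]; rfl
  have hGn : ∀ w, ‖G w‖ = ‖w‖ := fun w => by rw [hG, Submodule.norm_coe, e.symm.norm_map]
  refine ⟨F, G, F.contDiff.contDiffOn, G.contDiff.contDiffOn, fun x hx => ?_, fun w hw => ?_,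
    ⟨fun x hx => ?_, fun w _ => ?_⟩, fun x hx v hv => ?_⟩
  · obtain ⟨hPx, hx1⟩ := mem_fixedSphere.1 hx
    rw [mem_sphere_zero_iff_norm, hFn x hPx, hx1]
  · rw [mem_sphere_zero_iff_norm] at hw
    exact mem_fixedSphere.2 ⟨hPG w, by rw [hGn, hw]⟩
  · rw [hF x (mem_fixedSphere.1 hx).1, hG, e.symm_apply_apply]
  · rw [hF _ (hPG w)]
    exact e.apply_symm_apply w
  · rw [fderivWithin_apply_of_mem_tangentSubspace hx F.hasFDerivAt (fun _ _ => rfl) hv,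
      hFn v ((h.mem_tangentSubspace_fixedSphere hx).1 hv).1]

end IsBalancedInvolution

namespace IsFocalPair

variable {P : V →L[ℝ] V} {M : Set V} {d l : ℕ}

theorem levelSet_one (h : IsFocalPair P M d) : levelSet M (quadForm P) 1 = fixedSphere P := by
  ext x
  rw [mem_fixedSphere]
  constructor
  · rintro ⟨hx, h1⟩
    exact ⟨(h.involution.quadForm_eq_one_iff (h.norm_eq_one hx)).1 h1, h.norm_eq_one hx⟩
  · rintro ⟨hPx, hx⟩
    exact ⟨h.pos x hx hPx, (h.involution.quadForm_eq_one_iff hx).2 hPx⟩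

theorem levelSet_neg_one (h : IsFocalPair P M d) :
    levelSet M (quadForm P) (-1) = fixedSphere (-P) := by
  ext x
  rw [mem_fixedSphere]
  have h0 : ‖x‖ = 1 → (quadForm P x = -1 ↔ (-P) x = x) := fun hx => by
    rw [← h.involution.neg.quadForm_eq_one_iff hx, quadForm_neg, neg_eq_iff_eq_neg]
  constructor
  · rintro ⟨hx, h1⟩
    exact ⟨(h0 (h.norm_eq_one hx)).1 h1, h.norm_eq_one hx⟩
  · rintro ⟨hPx, hx⟩
    refine ⟨h.neg x hx ?_, (h0 hx).2 hPx⟩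
    rwa [neg_apply, neg_eq_iff_eq_neg] at hPx

theorem focal (h : IsFocalPair P M d) (hl : Module.finrank ℝ V = 2 * l) (hl1 : 1 ≤ l) {c : ℝ}
    (hc : c = 1 ∨ c = -1) :
    IsEmbeddedSubmanifold (levelSet M (quadForm P) c) (l - 1) ∧
    AreRiemannianIsometric (levelSet M (quadForm P) c)
      (Metric.sphere (0 : EuclideanSpace ℝ (Fin l)) 1) ∧
    IsTotallyGeodesicSubmanifold (levelSet M (quadForm P) c) M := by
  have hsub : levelSet M (quadForm P) c ⊆ M := fun x hx => hx.1
  rcases hc with rfl | rfl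
  · rw [h.levelSet_one] at hsub ⊢
    exact ⟨h.involution.isEmbeddedSubmanifold_fixedSphere hl hl1, h.involution.isometric_fixedSphere hl,
      h.involution.isTotallyGeodesic_fixedSphere hl hl1 h.submanifold h.subset_sphere hsub⟩
  · rw [h.levelSet_neg_one] at hsub ⊢
    exact ⟨h.involution.neg.isEmbeddedSubmanifold_fixedSphere hl hl1,
      h.involution.neg.isometric_fixedSphere hl,
      h.involution.neg.isTotallyGeodesic_fixedSphere hl hl1 h.submanifold h.subset_sphere hsub⟩

end IsFocalPair

end FocalSubmanifold

/-! ### Clifford families and the common zero sets M_i -/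

section CliffordFamily

variable {V : Type*} [NormedAddCommGroup V] [InnerProductSpace ℝ V] [FiniteDimensional ℝ V]
variable {ι : Type*} [DecidableEq ι]

/-- Anticommuting symmetric orthogonal involutions. -/
structure IsCliffordFamily (A : ι → V →L[ℝ] V) : Prop where
  symm : ∀ α x y, inner ℝ (A α x) y = inner ℝ x (A α y)
  sq : ∀ α x, A α (A α x) = x
  anti : ∀ α β, α ≠ β → ∀ x, A α (A β x) = -A β (A α x)

theorem trace_rankOne_comp_starProjection (a b : V) (K : Submodule ℝ V) :
    LinearMap.trace ℝ V (rankOne ℝ a b ∘L K.starProjection).toLinearMap =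
      inner ℝ (K.starProjection b) a := by
  have h1 : rankOne ℝ a b ∘L K.starProjection = rankOne ℝ a (K.starProjection b) := by
    ext v
    simp [Submodule.inner_starProjection_left_eq_right]
  rw [h1, trace_rankOne]

namespace IsCliffordFamily

variable {A : ι → V →L[ℝ] V} (hA : IsCliffordFamily A)
include hA

theorem inner_map_map_self (α : ι) (x y : V) : inner ℝ (A α x) (A α y) = inner ℝ x y := by
  rw [hA.symm, hA.sq]

theorem inner_map_map_of_ne {α β : ι} (h : α ≠ β) (x : V) : inner ℝ (A α x) (A β x) = 0 := by
  have h1 := hA.symm α x (A β x)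
  rw [hA.anti α β h, inner_neg_right, ← hA.symm β x, real_inner_comm (A α x) (A β x)] at h1
  linarith

theorem inner_comp_self_of_ne {α β : ι} (h : α ≠ β) (x : V) : inner ℝ (A α (A β x)) x = 0 := by
  rw [hA.symm, real_inner_comm, hA.inner_map_map_of_ne h]

theorem inner_map_map (α β : ι) (x : V) :
    inner ℝ (A α x) (A β x) = if α = β then ‖x‖ ^ 2 else 0 := by
  split_ifs with h
  · rw [h, hA.inner_map_map_self, real_inner_self_eq_norm_sq]
  · exact hA.inner_map_map_of_ne h x

/-- For three distinct indices, anticommutation and symmetry show that the inner product equals its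
own negative; for α = β one anticommutation suffices. This is the source of the scalar condition on
the normal space of M_i. -/
theorem inner_comp_map_of_ne {γ α β : ι} (hα : γ ≠ α) (hβ : γ ≠ β) (x : V) :
    inner ℝ (A γ (A α x)) (A β x) = if α = β then -quadForm (A γ) x else 0 := by
  split_ifs with h
  · rw [← h, hA.anti γ α hα, inner_neg_left, hA.inner_map_map_self]
    rfl
  · have h1 : inner ℝ (A γ (A α x)) (A β x) = -inner ℝ (A γ (A α x)) (A β x) := by
      conv_lhs => rw [hA.anti γ α hα, inner_neg_left, hA.symm α, hA.anti α β h, inner_neg_right,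
        neg_neg, ← hA.symm β, hA.anti β γ hβ.symm, inner_neg_left, hA.symm γ, real_inner_comm]
    linarith

theorem isBalancedInvolution {α β : ι} (h : α ≠ β) : IsBalancedInvolution (A α) where
  symm := hA.symm α
  sq := hA.sq α
  swap := ⟨A β, hA.sq β, hA.anti β α h.symm⟩

theorem trace_eq_zero {α β : ι} (h : α ≠ β) : LinearMap.trace ℝ V (A α).toLinearMap = 0 :=
  (hA.isBalancedInvolution h).trace_eq_zero

theorem quadForm_eq_zero {α β : ι} (h : α ≠ β) {x : V} (hx : A β x = x ∨ A β x = -x) :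
    quadForm (A α) x = 0 := by
  have h1 := hA.inner_map_map_of_ne h x
  rcases hx with hx | hx <;> rw [hx] at h1
  · exact h1
  · rw [inner_neg_right, neg_eq_zero] at h1
    exact h1

theorem quadForm_combination (α : ι) (u v : V) (a b : ℝ) :
    quadForm (A α) (a • u + b • v) =
      a ^ 2 * quadForm (A α) u + b ^ 2 * quadForm (A α) v + 2 * a * b * inner ℝ (A α u) v := by
  have h1 : inner ℝ (A α v) u = inner ℝ (A α u) v := by rw [hA.symm, real_inner_comm]
  simp only [quadForm, map_add, map_smul, inner_add_left, inner_add_right, inner_smul_left,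
    inner_smul_right, h1, conj_trivial]
  ring

end IsCliffordFamily

/-- The unit vectors at which the quadratic forms of the `A α`, `α ∈ s`, vanish. -/
def commonZeroSet (A : ι → V →L[ℝ] V) (s : Finset ι) : Set V :=
  {x ∈ Metric.sphere 0 1 | ∀ α ∈ s, quadForm (A α) x = 0}

theorem mem_commonZeroSet {A : ι → V →L[ℝ] V} {s : Finset ι} {x : V} :
    x ∈ commonZeroSet A s ↔ ‖x‖ = 1 ∧ ∀ α ∈ s, quadForm (A α) x = 0 := by
  rw [commonZeroSet, mem_ofPred_eq, mem_sphere_zero_iff_norm]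

/-- The defining equations of `commonZeroSet`. -/
def zeroSetEquations (A : ι → V →L[ℝ] V) (s : Finset ι) (x : V) : ℝ × (s → ℝ) :=
  (quadForm (.id ℝ V) x - 1, fun α => quadForm (A α) x)

namespace IsCliffordFamily

variable {A : ι → V →L[ℝ] V} {s : Finset ι} {l : ℕ}

theorem hasFDerivAt_zeroSetEquations (hA : IsCliffordFamily A) (x : V) :
    HasFDerivAt (zeroSetEquations A s) ((innerSL ℝ ((2 : ℝ) • x)).prod
      (ContinuousLinearMap.pi fun α : s => innerSL ℝ ((2 : ℝ) • A α x))) x :=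
  ((hasFDerivAt_quadForm (fun _ _ => rfl) x).sub_const 1).prodMk
    (hasFDerivAt_pi.2 fun α => hasFDerivAt_quadForm (hA.symm α) x)

/-- On M_i the vectors x and A_α x are orthonormal, so pairing with them reads off coefficients.
This gives surjectivity of the differential of the equations and the formula for the tangent
projection. -/
theorem inner_normal_combination (hA : IsCliffordFamily A) {x : V} (hx : x ∈ commonZeroSet A s)
    (a : ℝ) (b : ι → ℝ) :
    inner ℝ x (a • x + ∑ α ∈ s, b α • A α x) = a ∧
      ∀ β ∈ s, inner ℝ (A β x) (a • x + ∑ α ∈ s, b α • A α x) = b β := by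
  obtain ⟨hx1, hx0⟩ := mem_commonZeroSet.1 hx
  have h0 : ∀ α ∈ s, inner ℝ (A α x) x = (0 : ℝ) := hx0
  constructor
  · rw [inner_add_right, inner_smul_right, inner_sum, real_inner_self_eq_norm_sq, hx1,
      Finset.sum_eq_zero]
    · ring
    · intro α hα
      rw [inner_smul_right, real_inner_comm, h0 α hα, mul_zero]
  · intro β hβ
    rw [inner_add_right, inner_smul_right, h0 β hβ, inner_sum]
    simp only [inner_smul_right, hA.inner_map_map, hx1]
    simp [hβ]

theorem definesNear_commonZeroSet (hA : IsCliffordFamily A) {x : V} (hx : x ∈ commonZeroSet A s) :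
    DefinesNear (commonZeroSet A s) (zeroSetEquations A s) x := by
  refine ⟨univ, isOpen_univ, mem_univ x, ?_, ?_, ?_⟩
  · exact (((contDiff_quadForm _).sub contDiff_const).prodMk
      (contDiff_pi.2 fun α => contDiff_quadForm _)).contDiffOn
  · ext y
    simp only [inter_univ, mem_ofPred_eq, mem_univ, true_and, mem_commonZeroSet, zeroSetEquations,
      Prod.mk_eq_zero, sub_eq_zero, quadForm_id]
    rw [pow_eq_one_iff_of_nonneg (norm_nonneg y) two_ne_zero, funext_iff]
    simp
  · rw [(hA.hasFDerivAt_zeroSetEquations x).fderiv]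
    rintro ⟨a, b⟩
    obtain ⟨h1, h2⟩ := hA.inner_normal_combination hx (a / 2)
      (fun α => if h : α ∈ s then b ⟨α, h⟩ / 2 else 0)
    refine ⟨(a / 2) • x + ∑ α ∈ s, (if h : α ∈ s then b ⟨α, h⟩ / 2 else 0) • A α x,
      Prod.ext ?_ (funext fun α => ?_)⟩
    · change inner ℝ ((2 : ℝ) • x) _ = a
      rw [inner_smul_left, h1]
      simp
      ring
    · change inner ℝ ((2 : ℝ) • A α x) _ = b α
      rw [inner_smul_left, h2 α α.2]
      simp
      ring

theorem card_add_one_le (hA : IsCliffordFamily A) {x : V} (hx : x ∈ commonZeroSet A s) :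
    s.card + 1 ≤ Module.finrank ℝ V := by
  obtain ⟨-, -, -, -, -, h1⟩ := hA.definesNear_commonZeroSet hx
  have h2 := LinearMap.finrank_le_finrank_of_surjective (f := (fderiv ℝ (zeroSetEquations A s) x).toLinearMap) h1
  simpa [Module.finrank_prod, add_comm] using h2

/-- Truncation in the dimension is harmless: a point of the set supplies 1 + |s| independent normal
directions, and without a point there is nothing to prove. -/
theorem isEmbeddedSubmanifold_commonZeroSet (hA : IsCliffordFamily A) :
    IsEmbeddedSubmanifold (commonZeroSet A s) (Module.finrank ℝ V - s.card - 1) := by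
  refine isEmbeddedSubmanifold_of_definesNear (fun x hx => hA.definesNear_commonZeroSet hx) ?_
  rintro ⟨x, hx⟩
  have := hA.card_add_one_le hx
  simp [Module.finrank_prod]
  omega

theorem mem_tangentSubspace_commonZeroSet (hA : IsCliffordFamily A) {x : V}
    (hx : x ∈ commonZeroSet A s) {v : V} :
    v ∈ tangentSubspace (commonZeroSet A s) x ↔
      inner ℝ x v = 0 ∧ ∀ α ∈ s, inner ℝ (A α x) v = 0 := by
  rw [(hA.definesNear_commonZeroSet hx).tangentSubspace_eq hx, LinearMap.mem_ker,
    ContinuousLinearMap.coe_coe, (hA.hasFDerivAt_zeroSetEquations x).fderiv]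
  simp [Prod.ext_iff, funext_iff]

/-- The orthogonal projection to the tangent space at `x` of `commonZeroSet A s`. -/
def zeroSetProjection (A : ι → V →L[ℝ] V) (s : Finset ι) (x : V) : V →L[ℝ] V :=
  ContinuousLinearMap.id ℝ V - (rankOne ℝ x x + ∑ α ∈ s, rankOne ℝ (A α x) (A α x))

theorem zeroSetProjection_apply (x w : V) : zeroSetProjection A s x w =
    w - (inner ℝ x w • x + ∑ α ∈ s, inner ℝ (A α x) w • A α x) := by
  simp [zeroSetProjection]

theorem starProjection_commonZeroSet (hA : IsCliffordFamily A) {x : V}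
    (hx : x ∈ commonZeroSet A s) :
    (tangentSubspace (commonZeroSet A s) x).starProjection = zeroSetProjection A s x := by
  ext w
  rw [zeroSetProjection_apply]
  obtain ⟨h1, h2⟩ := hA.inner_normal_combination hx (inner ℝ x w) fun α => inner ℝ (A α x) w
  refine starProjection_eq_of_mem ?_ fun v hv => ?_
  · rw [hA.mem_tangentSubspace_commonZeroSet hx]
    refine ⟨by rw [inner_sub_right, h1, sub_self], fun α hα => by
      rw [inner_sub_right, h2 α hα, sub_self]⟩
  · rw [hA.mem_tangentSubspace_commonZeroSet hx] at hv
    rw [sub_sub_cancel, real_inner_comm, inner_add_left, inner_smul_left, hv.1, sum_inner,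
      Finset.sum_eq_zero, mul_zero, zero_add]
    intro α hα
    rw [inner_smul_left, hv.2 α hα, mul_zero]

theorem isFocalTangent_commonZeroSet (hA : IsCliffordFamily A) {β : ι} (hβ : β ∉ s) {x : V}
    (hx : x ∈ commonZeroSet A s) :
    IsFocalTangent (A β) (tangentSubspace (commonZeroSet A s) x) x where
  unit := (mem_commonZeroSet.1 hx).1
  perp v hv := ((hA.mem_tangentSubspace_commonZeroSet hx).1 hv).1
  grad := by
    obtain ⟨hx1, hx0⟩ := mem_commonZeroSet.1 hx
    refine (hA.mem_tangentSubspace_commonZeroSet hx).2 ⟨?_, fun α hα => ?_⟩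
    · rw [inner_sub_right, inner_smul_right, real_inner_self_eq_norm_sq, hx1, real_inner_comm,
        quadForm]
      ring
    · have h0 : inner ℝ (A α x) x = (0 : ℝ) := hx0 α hα
      rw [inner_sub_right, inner_smul_right, h0,
        hA.inner_map_map_of_ne (ne_of_mem_of_not_mem hα hβ)]
      ring
  normal w hw w' hw' hxw hxw' := by
    obtain ⟨hx1, hx0⟩ := mem_commonZeroSet.1 hx
    have key : ∀ w ∈ (tangentSubspace (commonZeroSet A s) x)ᗮ, inner ℝ x w = 0 →
        w = ∑ α ∈ s, inner ℝ (A α x) w • A α x := by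
      intro w hw hxw
      have h1 := (Submodule.starProjection_apply_eq_zero_iff _).2 hw
      rw [hA.starProjection_commonZeroSet hx, zeroSetProjection_apply, hxw, zero_smul, zero_add,
        sub_eq_zero] at h1
      exact h1
    have h2 : ∀ α ∈ s, ∀ α' ∈ s, inner ℝ (A β (A α x)) (A α' x) =
        -quadForm (A β) x * inner ℝ (A α x) (A α' x) := by
      intro α hα α' hα'
      rw [hA.inner_comp_map_of_ne (ne_of_mem_of_not_mem hα hβ).symm
        (ne_of_mem_of_not_mem hα' hβ).symm, hA.inner_map_map, hx1]
      split_ifs <;> ring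
    rw [key w hw hxw, key w' hw' hxw', map_sum]
    simp only [sum_inner, inner_sum, Finset.mul_sum, map_smul, inner_smul_left, inner_smul_right]
    refine Finset.sum_congr rfl fun α hα => Finset.sum_congr rfl fun α' hα' => ?_
    rw [h2 _ hα' _ hα]
    ring

theorem isClosed_commonZeroSet : IsClosed (commonZeroSet A s) := by
  have h1 : commonZeroSet A s =
      Metric.sphere 0 1 ∩ ⋂ α ∈ s, {x | quadForm (A α) x = 0} := by
    ext x
    simp [commonZeroSet]
  rw [h1]
  exact Metric.isClosed_sphere.inter (isClosed_biInter fun α _ =>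
    isClosed_eq (contDiff_quadForm _).continuous continuous_const)

theorem norm_three_four_combination {u v : V} (hu : ‖u‖ = 1) (hv : ‖v‖ = 1)
    (huv : inner ℝ u v = 0) : ‖(3 / 5 : ℝ) • u + (4 / 5 : ℝ) • v‖ = 1 := by
  rw [← pow_eq_one_iff_of_nonneg (norm_nonneg _) two_ne_zero, norm_add_sq_real, norm_smul, norm_smul,
    inner_smul_left, inner_smul_right, huv, hu, hv]
  norm_num

theorem isFocalPair_commonZeroSet (hA : IsCliffordFamily A) {β : ι} (hβ : β ∉ s) (hs : s.Nonempty)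
    (hl : Module.finrank ℝ V = 2 * l) (hsl : s.card < l) :
    IsFocalPair (A β) (commonZeroSet A s) (2 * l - s.card - 1) where
  involution := by
    obtain ⟨α, hα⟩ := hs
    exact hA.isBalancedInvolution (ne_of_mem_of_not_mem hα hβ).symm
  closed := isClosed_commonZeroSet
  subset_sphere _ hx := hx.1
  submanifold := hl ▸ hA.isEmbeddedSubmanifold_commonZeroSet
  tangent _ hx := hA.isFocalTangent_commonZeroSet hβ hx
  pos _ hx hPx := mem_commonZeroSet.2 ⟨hx, fun _ hα =>
    hA.quadForm_eq_zero (ne_of_mem_of_not_mem hα hβ) (Or.inl hPx)⟩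
  neg _ hx hPx := mem_commonZeroSet.2 ⟨hx, fun _ hα =>
    hA.quadForm_eq_zero (ne_of_mem_of_not_mem hα hβ) (Or.inr hPx)⟩
  join u v hu hv huv a b hab := by
    refine mem_commonZeroSet.2 ⟨hab, fun α hα => ?_⟩
    have hne := ne_of_mem_of_not_mem hα hβ
    have h1 := (mem_commonZeroSet.1 huv).2 α hα
    have h2 := hA.quadForm_combination α u v 1 1
    rw [one_smul, one_smul, h1, hA.quadForm_eq_zero hne (Or.inl hu),
      hA.quadForm_eq_zero hne (Or.inr hv)] at h2
    rw [hA.quadForm_combination, hA.quadForm_eq_zero hne (Or.inl hu),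
      hA.quadForm_eq_zero hne (Or.inr hv)]
    -- Only the cross term 2ab⟨A_α u, v⟩ survives, and it vanishes for all a, b once it does for a =
    -- b = 1.
    linear_combination -(a * b) * h2
  opposite v hv hPv := by
    obtain ⟨α₀, hα₀⟩ := hs
    have hb := hA.isBalancedInvolution (ne_of_mem_of_not_mem hα₀ hβ).symm
    classical
    -- The fixed space has dimension l and W has dimension at most |s| < l, so some nonzero fixed
    -- vector is orthogonal to every A_α v; this kills the cross terms.
    let W : Submodule ℝ V := Submodule.span ℝ ((s.image fun α => A α v : Finset V) : Set V)
    have hW : Module.finrank ℝ W ≤ s.card :=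
      (finrank_span_finset_le_card _).trans Finset.card_image_le
    have h1 := hb.finrank_fixedSpace hl
    have h2 := W.finrank_add_finrank_orthogonal
    have h3 := Submodule.finrank_sup_add_finrank_inf_eq (fixedSpace (A β)) Wᗮ
    have h4 := Submodule.finrank_le (fixedSpace (A β) ⊔ Wᗮ)
    have h5 : 0 < Module.finrank ℝ (fixedSpace (A β) ⊓ Wᗮ : Submodule ℝ V) := by omega
    have := Module.nontrivial_of_finrank_pos h5
    obtain ⟨⟨w, hwf, hwW⟩, hw⟩ := exists_ne (0 : (fixedSpace (A β) ⊓ Wᗮ : Submodule ℝ V))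
    have hw0 : w ≠ 0 := fun h => hw (Subtype.ext h)
    have hu1 : ‖‖w‖⁻¹ • w‖ = 1 := by
      rw [norm_smul, norm_inv, norm_norm, inv_mul_cancel₀ (norm_ne_zero_iff.2 hw0)]
    have huP : A β (‖w‖⁻¹ • w) = ‖w‖⁻¹ • w := by rw [map_smul, mem_fixedSpace.1 hwf]
    refine ⟨‖w‖⁻¹ • w, hu1, huP, mem_commonZeroSet.2
      ⟨norm_three_four_combination hu1 hv (hb.inner_eq_zero huP hPv), fun α hα => ?_⟩⟩
    have hne := ne_of_mem_of_not_mem hα hβ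
    have h6 : inner ℝ (A α (‖w‖⁻¹ • w)) v = 0 := by
      rw [hA.symm, inner_smul_left, real_inner_comm,
        (W.mem_orthogonal w).1 hwW _ (Submodule.subset_span (by
          simp only [Finset.coe_image]; exact ⟨α, hα, rfl⟩)), mul_zero]
    rw [hA.quadForm_combination, hA.quadForm_eq_zero hne (Or.inl huP),
      hA.quadForm_eq_zero hne (Or.inr hPv), h6]
    ring

theorem levelSet_commonZeroSet {β : ι} :
    levelSet (commonZeroSet A s) (quadForm (A β)) 0 = commonZeroSet A (insert β s) := by
  ext x
  simp only [levelSet, mem_ofPred_eq, mem_commonZeroSet, Finset.forall_mem_insert]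
  tauto

/-- The second fundamental form is B(Y, Y) = −∑ ⟨A_α Y, Y⟩ A_α x over α ∈ t \ s, so minimality means
that each such A_α has trace zero over the tangent space of the smaller manifold. -/
theorem isMinimalSubmanifold_commonZeroSet (hA : IsCliffordFamily A) {t : Finset ι} (hst : s ⊆ t)
    (hs : s.Nonempty) : IsMinimalSubmanifold (commonZeroSet A t) (commonZeroSet A s) where
  ambient := ⟨_, hA.isEmbeddedSubmanifold_commonZeroSet⟩
  submanifold := ⟨_, hA.isEmbeddedSubmanifold_commonZeroSet⟩
  subset x hx := mem_commonZeroSet.2 ⟨(mem_commonZeroSet.1 hx).1,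
    fun α hα => (mem_commonZeroSet.1 hx).2 α (hst hα)⟩
  meanCurvature x hx := by
    obtain ⟨hx1, hx0⟩ := mem_commonZeroSet.1 hx
    have hxs : x ∈ commonZeroSet A s := mem_commonZeroSet.2 ⟨hx1, fun α hα => hx0 α (hst hα)⟩
    have hq : ∀ α ∈ t, inner ℝ (A α x) x = (0 : ℝ) := hx0
    set T := tangentSubspace (commonZeroSet A t) x with hT
    have hB : ∀ Y ∈ T, secondFundamentalForm (commonZeroSet A t) (commonZeroSet A s) x Y Y =
        -∑ α ∈ t \ s, inner ℝ (A α Y) Y • A α x := by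
      intro Y hY
      obtain ⟨hY1, hY2⟩ := (hA.mem_tangentSubspace_commonZeroSet hx).1 hY
      have hlin : ∀ L : V →L[ℝ] V, HasFDerivAt (fun y => inner ℝ (L y) Y) (innerSL ℝ Y ∘L L) x :=
        fun L => ((innerSL ℝ Y ∘L L).hasFDerivAt (x := x)).congr_of_eventuallyEq
          (Eventually.of_forall fun y => real_inner_comm Y (L y))
      have hD : HasFDerivAt (fun y => zeroSetProjection A t y Y)
          (-(inner ℝ x Y • ContinuousLinearMap.id ℝ V + (innerSL ℝ Y).smulRight x +
            ∑ α ∈ t, (inner ℝ (A α x) Y • A α + (innerSL ℝ Y ∘L A α).smulRight (A α x)))) x := by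
        simp only [zeroSetProjection_apply]
        exact (((hlin (.id ℝ V)).smul (hasFDerivAt_id x)).add (HasFDerivAt.fun_sum fun α _ =>
          (hlin (A α)).smul (A α).hasFDerivAt)).const_sub _
      have hDY : (-(inner ℝ x Y • ContinuousLinearMap.id ℝ V + (innerSL ℝ Y).smulRight x +
            ∑ α ∈ t, (inner ℝ (A α x) Y • A α + (innerSL ℝ Y ∘L A α).smulRight (A α x)))) Y =
          -(inner ℝ Y Y • x + ∑ α ∈ t, inner ℝ (A α Y) Y • A α x) := by
        rw [hY1]
        simp only [neg_apply, add_apply, zero_smul, zero_add, _root_.sum_apply,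
          ContinuousLinearMap.smulRight_apply, innerSL_apply_apply, ContinuousLinearMap.comp_apply]
        congr 2
        refine Finset.sum_congr rfl fun α hα => ?_
        rw [hY2 α hα, zero_smul, zero_apply, zero_add, real_inner_comm]
      have hproj : ∀ r : Finset ι, r ⊆ t → x ∈ commonZeroSet A r →
          (tangentSubspace (commonZeroSet A r) x).starProjection
            (-(inner ℝ Y Y • x + ∑ α ∈ t, inner ℝ (A α Y) Y • A α x)) =
          -∑ α ∈ t \ r, inner ℝ (A α Y) Y • A α x := by
        intro r hr hxr
        obtain ⟨h1, h2⟩ := hA.inner_normal_combination hx (inner ℝ Y Y)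
          fun α => inner ℝ (A α Y) Y
        rw [map_neg, hA.starProjection_commonZeroSet hxr, zeroSetProjection_apply, h1,
          Finset.sum_congr rfl fun α (hα : α ∈ r) => congrArg (· • A α x) (h2 α (hr hα)),
          ← Finset.sum_sdiff hr]
        abel
      rw [secondFundamentalForm_eq hx hY hD fun y hy => by rw [hA.starProjection_commonZeroSet hy],
        hDY, hproj s hst hxs, hproj t subset_rfl hx]
      simp
    rw [meanCurvatureVector, Finset.sum_congr rfl fun a _ => hB _ (Subtype.coe_prop _),
      Finset.sum_neg_distrib, Finset.sum_comm, neg_eq_zero]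
    refine Finset.sum_eq_zero fun α hα => ?_
    obtain ⟨hαt, hαs⟩ := Finset.mem_sdiff.1 hα
    obtain ⟨β, hβ⟩ := hs
    -- The full trace vanishes because A_α anticommutes with a member of s. The normal directions x
    -- and A_γ x contribute only multiples of ⟨A_α x, x⟩, which is 0 here.
    have htr : LinearMap.trace ℝ V (A α ∘L T.starProjection).toLinearMap = 0 := by
      have h1 : A α ∘L T.starProjection = A α - (rankOne ℝ (A α x) x +
          ∑ β ∈ t, rankOne ℝ (A α (A β x)) (A β x)) := by
        rw [hA.starProjection_commonZeroSet hx]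
        ext v
        simp [zeroSetProjection_apply]
      rw [h1]
      simp only [ContinuousLinearMap.toLinearMap_sub, ContinuousLinearMap.toLinearMap_add,
        ContinuousLinearMap.toLinearMap_sum, map_sub, map_add, map_sum, trace_rankOne,
        hA.trace_eq_zero (ne_of_mem_of_not_mem hβ hαs).symm]
      rw [real_inner_comm, hq α hαt, Finset.sum_eq_zero]
      · ring
      intro γ hγ
      rw [real_inner_comm]
      rcases eq_or_ne α γ with rfl | hne
      · rw [hA.sq, real_inner_comm, hq α hαt]
      · rw [hA.inner_comp_map_of_ne hne hne, if_pos rfl]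
        exact neg_eq_zero.2 (hx0 α hαt)
    rw [← Finset.sum_smul, sum_inner_orthonormalBasis, htr, zero_smul]

end IsCliffordFamily

end CliffordFamily

/-! ### The sets N_i: moment operator, normal projection and defining equations -/

section UnitSquareSum

variable {V : Type*} [NormedAddCommGroup V] [InnerProductSpace ℝ V] [FiniteDimensional ℝ V]
variable {ι : Type*} [DecidableEq ι]

/-- The unit vectors at which the squares of the quadratic forms of the `A α`, `α ∈ s`, add up
to `1`. -/
def unitSquareSumSet (A : ι → V →L[ℝ] V) (s : Finset ι) : Set V :=
  {x ∈ Metric.sphere 0 1 | ∑ α ∈ s, quadForm (A α) x ^ 2 = 1}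

theorem mem_unitSquareSumSet {A : ι → V →L[ℝ] V} {s : Finset ι} {x : V} :
    x ∈ unitSquareSumSet A s ↔ ‖x‖ = 1 ∧ ∑ α ∈ s, quadForm (A α) x ^ 2 = 1 := by
  rw [unitSquareSumSet, mem_ofPred_eq, mem_sphere_zero_iff_norm]

/-- The combination of the `A α` with the values at `x` of their quadratic forms as coefficients. -/
def momentOperator (A : ι → V →L[ℝ] V) (s : Finset ι) (x : V) : V →L[ℝ] V :=
  ∑ α ∈ s, quadForm (A α) x • A α

theorem momentOperator_apply (A : ι → V →L[ℝ] V) (s : Finset ι) (x v : V) :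
    momentOperator A s x v = ∑ α ∈ s, quadForm (A α) x • A α v := by
  simp [momentOperator]

/-- At the points of `unitSquareSumSet A s`: the orthogonal projection to the normal space in the
unit sphere. -/
def normalProjection (A : ι → V →L[ℝ] V) (s : Finset ι) (x : V) : V →L[ℝ] V :=
  (1 / 2 : ℝ) • (ContinuousLinearMap.id ℝ V - momentOperator A s x) -
    ∑ α ∈ s, rankOne ℝ (A α x) (A α x) + rankOne ℝ x x

theorem normalProjection_apply (A : ι → V →L[ℝ] V) (s : Finset ι) (x v : V) :
    normalProjection A s x v = (1 / 2 : ℝ) • (v - momentOperator A s x v) -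
      ∑ α ∈ s, inner ℝ (A α x) v • A α x + inner ℝ x v • x := by
  simp [normalProjection]

/-- The equation of the cone over `unitSquareSumSet A s`. -/
def coneEquation (A : ι → V →L[ℝ] V) (s : Finset ι) (y : V) : V :=
  (1 / 2 : ℝ) • (quadForm (.id ℝ V) y • y - momentOperator A s y y)

namespace IsCliffordFamily

variable {A : ι → V →L[ℝ] V} {s : Finset ι} {l : ℕ}

/-- The square of a combination of anticommuting involutions is scalar: the mixed terms cancel in
pairs. -/
theorem sum_smul_sq (hA : IsCliffordFamily A) (c : ι → ℝ) (v : V) :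
    ∑ α ∈ s, c α • A α (∑ β ∈ s, c β • A β v) = (∑ α ∈ s, c α ^ 2) • v := by
  induction s using Finset.induction_on with
  | empty => simp
  | insert γ s hγ ih =>
    have h1 : ∑ α ∈ s, c α • A α (c γ • A γ v) = -(c γ • A γ (∑ β ∈ s, c β • A β v)) := by
      rw [map_sum, Finset.smul_sum, ← Finset.sum_neg_distrib]
      refine Finset.sum_congr rfl fun α hα => ?_
      rw [map_smul, map_smul, hA.anti α γ (ne_of_mem_of_not_mem hα hγ), smul_neg, smul_neg,
        smul_comm]
    simp only [Finset.sum_insert hγ, map_add, smul_add, Finset.sum_add_distrib]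
    rw [ih, h1, map_smul, hA.sq, add_smul, smul_smul, pow_two (c γ)]
    abel

theorem momentOperator_momentOperator (hA : IsCliffordFamily A) (x v : V) :
    momentOperator A s x (momentOperator A s x v) = (∑ α ∈ s, quadForm (A α) x ^ 2) • v := by
  simp only [momentOperator_apply]
  exact hA.sum_smul_sq _ v

theorem momentOperator_symm (hA : IsCliffordFamily A) (x v w : V) :
    inner ℝ (momentOperator A s x v) w = inner ℝ v (momentOperator A s x w) := by
  simp only [momentOperator_apply, sum_inner, inner_sum, inner_smul_left, inner_smul_right, hA.symm,
    conj_trivial]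

theorem momentOperator_anticomm (hA : IsCliffordFamily A) {β : ι} (hβ : β ∈ s) (x v : V) :
    momentOperator A s x (A β v) = -A β (momentOperator A s x v) + (2 * quadForm (A β) x) • v := by
  rw [eq_neg_add_iff_add_eq, momentOperator_apply, momentOperator_apply, map_sum,
    ← Finset.sum_add_distrib, Finset.sum_eq_single_of_mem β hβ]
  · rw [map_smul, hA.sq]
    module
  · intro α _ hne
    rw [map_smul, hA.anti α β hne, smul_neg, add_neg_cancel]

theorem inner_momentOperator_self (x : V) :
    inner ℝ (momentOperator A s x x) x = ∑ α ∈ s, quadForm (A α) x ^ 2 := by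
  simp only [momentOperator_apply, sum_inner, inner_smul_left, conj_trivial, pow_two]
  rfl

/-- For a unit vector x and K = ∑ ⟨A_α x, x⟩², both |Q_x x|² and ⟨Q_x x, x⟩ equal K, so |Q_x x − x|²
= 1 − K. -/
theorem mem_unitSquareSumSet_iff (hA : IsCliffordFamily A) {x : V} :
    x ∈ unitSquareSumSet A s ↔ ‖x‖ = 1 ∧ momentOperator A s x x = x := by
  rw [mem_unitSquareSumSet, and_congr_right_iff]
  intro hx
  have h1 := norm_sub_sq_real (momentOperator A s x x) x
  have h2 : ‖momentOperator A s x x‖ ^ 2 = ∑ α ∈ s, quadForm (A α) x ^ 2 := by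
    rw [← real_inner_self_eq_norm_sq, hA.momentOperator_symm, hA.momentOperator_momentOperator,
      inner_smul_right, real_inner_self_eq_norm_sq, hx]
    ring
  rw [h2, inner_momentOperator_self, hx] at h1
  constructor
  · intro h
    rw [h] at h1
    norm_num at h1
    exact sub_eq_zero.1 h1
  · intro h
    rw [h, sub_self, norm_zero] at h1
    linarith

section Point

variable {x : V}

theorem momentOperator_involutive (hA : IsCliffordFamily A) (hx : x ∈ unitSquareSumSet A s) (v : V) :
    momentOperator A s x (momentOperator A s x v) = v := by
  rw [hA.momentOperator_momentOperator, (mem_unitSquareSumSet.1 hx).2, one_smul]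

theorem momentOperator_self (hA : IsCliffordFamily A) (hx : x ∈ unitSquareSumSet A s) :
    momentOperator A s x x = x := (hA.mem_unitSquareSumSet_iff.1 hx).2

theorem normalProjection_symm (hA : IsCliffordFamily A) (v w : V) :
    inner ℝ (normalProjection A s x v) w = inner ℝ v (normalProjection A s x w) := by
  simp only [normalProjection_apply, inner_add_left, inner_add_right, inner_sub_left,
    inner_sub_right, inner_smul_left, inner_smul_right, sum_inner, inner_sum, conj_trivial,
    hA.momentOperator_symm]
  rw [real_inner_comm x v, mul_comm (inner ℝ x v)]
  congr 2
  refine Finset.sum_congr rfl fun α _ => ?_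
  rw [real_inner_comm (A α x) v, mul_comm]

theorem sum_inner_map_base (hA : IsCliffordFamily A) (hx : x ∈ unitSquareSumSet A s) :
    ∑ α ∈ s, inner ℝ (A α x) x • A α x = x := by
  have := hA.momentOperator_self hx
  rw [momentOperator_apply] at this
  exact this

theorem normalProjection_base (hA : IsCliffordFamily A) (hx : x ∈ unitSquareSumSet A s) :
    normalProjection A s x x = 0 := by
  rw [normalProjection_apply, hA.momentOperator_self hx, hA.sum_inner_map_base hx,
    real_inner_self_eq_norm_sq, (mem_unitSquareSumSet.1 hx).1]
  simp

theorem sum_inner_map_map (hA : IsCliffordFamily A) (hx : ‖x‖ = 1) {β : ι} (hβ : β ∈ s) :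
    ∑ α ∈ s, inner ℝ (A α x) (A β x) • A α x = A β x := by
  simp only [hA.inner_map_map, hx]
  simp [hβ]

theorem normalProjection_map_base (hA : IsCliffordFamily A) (hx : x ∈ unitSquareSumSet A s) {β : ι}
    (hβ : β ∈ s) : normalProjection A s x (A β x) = 0 := by
  have h1 : inner ℝ x (A β x) = quadForm (A β) x := by rw [← hA.symm]; rfl
  rw [normalProjection_apply, hA.momentOperator_anticomm hβ, hA.momentOperator_self hx,
    hA.sum_inner_map_map (mem_unitSquareSumSet.1 hx).1 hβ, h1]
  module

/-- The range of the normal projection lies in the (−1)-eigenspace of Q_x: it is that eigenspace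
without the vectors of span{A_α x} orthogonal to x. -/
theorem normalProjection_momentOperator (hA : IsCliffordFamily A) (hx : x ∈ unitSquareSumSet A s)
    (v : V) : normalProjection A s x (momentOperator A s x v) = -normalProjection A s x v := by
  have h1 : inner ℝ x (momentOperator A s x v) = inner ℝ x v := by
    rw [← hA.momentOperator_symm, hA.momentOperator_self hx]
  have h2 : ∑ α ∈ s, inner ℝ (A α x) (momentOperator A s x v) • A α x =
      -∑ α ∈ s, inner ℝ (A α x) v • A α x + (2 * inner ℝ x v) • x := by
    conv_rhs => rw [← hA.sum_inner_map_base hx]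
    rw [Finset.smul_sum, ← Finset.sum_neg_distrib, ← Finset.sum_add_distrib]
    refine Finset.sum_congr rfl fun α hα => ?_
    rw [← hA.momentOperator_symm, hA.momentOperator_anticomm hα, hA.momentOperator_self hx,
      inner_add_left, inner_neg_left, inner_smul_left, hA.sum_inner_map_base hx]
    simp only [conj_trivial, quadForm]
    module
  rw [normalProjection_apply, normalProjection_apply, hA.momentOperator_involutive hx, h1, h2]
  module

/-- The terms in x and A_α x are annihilated, and on ½(v − Q_x v) the projection has the same value
as on v. -/
theorem normalProjection_idem (hA : IsCliffordFamily A) (hx : x ∈ unitSquareSumSet A s) (v : V) :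
    normalProjection A s x (normalProjection A s x v) = normalProjection A s x v := by
  conv_lhs => rw [normalProjection_apply A s x v]
  rw [map_add, map_sub, map_smul, map_sub, hA.normalProjection_momentOperator hx, map_smul,
    hA.normalProjection_base hx, map_sum, Finset.sum_eq_zero]
  · module
  · intro α hα
    rw [map_smul, hA.normalProjection_map_base hx hα, smul_zero]

/-- All A_α are traceless because each anticommutes with another member of s, so only l, the |s|
unit rank-one terms and the final +1 remain. For an idempotent this trace is the rank, the
codimension of N_i in the sphere. -/
theorem trace_normalProjection (hA : IsCliffordFamily A) (hx : x ∈ unitSquareSumSet A s)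
    (hl : Module.finrank ℝ V = 2 * l) (hs : s.Nontrivial) :
    LinearMap.trace ℝ V (normalProjection A s x).toLinearMap = l - s.card + 1 := by
  have h1 : ∀ α ∈ s, LinearMap.trace ℝ V (A α).toLinearMap = 0 := fun α hα => by
    obtain ⟨β, -, hβ⟩ := hs.exists_ne α
    exact hA.trace_eq_zero hβ.symm
  simp only [normalProjection, momentOperator, ContinuousLinearMap.toLinearMap_sub,
    ContinuousLinearMap.toLinearMap_add, ContinuousLinearMap.toLinearMap_sum,
    ContinuousLinearMap.toLinearMap_smul, map_sub, map_add, map_sum, map_smul, trace_rankOne,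
    ContinuousLinearMap.coe_id, LinearMap.trace_id, hl, hA.inner_map_map_self,
    real_inner_self_eq_norm_sq, (mem_unitSquareSumSet.1 hx).1]
  rw [Finset.sum_eq_zero fun α hα => by rw [h1 α hα, smul_zero]]
  simp

theorem finrank_range_normalProjection (hA : IsCliffordFamily A) (hx : x ∈ unitSquareSumSet A s)
    (hl : Module.finrank ℝ V = 2 * l) (hs : s.Nontrivial) :
    Module.finrank ℝ (LinearMap.range (normalProjection A s x).toLinearMap) + s.card = l + 1 := by
  have hidem : IsIdempotentElem (normalProjection A s x).toLinearMap := by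
    ext v
    exact hA.normalProjection_idem hx v
  have h1 := (LinearMap.IsIdempotentElem.isProj_range _ hidem).trace
  rw [hA.trace_normalProjection hx hl hs] at h1
  have h2 : ((Module.finrank ℝ (LinearMap.range (normalProjection A s x).toLinearMap) + s.card : ℕ) : ℝ) =
      ((l + 1 : ℕ) : ℝ) := by
    push_cast
    linarith
  exact_mod_cast h2

theorem hasFDerivAt_momentOperator_apply (hA : IsCliffordFamily A) (y : V) (Y : V) :
    HasFDerivAt (fun y => momentOperator A s y Y)
      (∑ α ∈ s, (innerSL ℝ ((2 : ℝ) • A α y)).smulRight (A α Y)) y := by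
  simp only [momentOperator_apply]
  exact HasFDerivAt.fun_sum fun α _ => (hasFDerivAt_quadForm (hA.symm α) y).smul_const _

theorem hasFDerivAt_coneEquation (hA : IsCliffordFamily A) (hx : x ∈ unitSquareSumSet A s) :
    HasFDerivAt (coneEquation A s) (normalProjection A s x) x := by
  have h1 : HasFDerivAt (fun y => momentOperator A s y y)
      (∑ α ∈ s, (quadForm (A α) x • A α + (innerSL ℝ ((2 : ℝ) • A α x)).smulRight (A α x))) x := by
    simp only [momentOperator_apply]
    exact HasFDerivAt.fun_sum fun α _ => (hasFDerivAt_quadForm (hA.symm α) x).smul (A α).hasFDerivAt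
  have h2 := (((hasFDerivAt_quadForm (P := .id ℝ V) (fun _ _ => rfl) x).smul
    (hasFDerivAt_id x)).sub h1).const_smul (1 / 2 : ℝ)
  refine h2.congr_fderiv ?_
  ext v
  simp only [normalProjection_apply, momentOperator_apply, quadForm_id,
    (mem_unitSquareSumSet.1 hx).1, smul_apply, sub_apply, add_apply, _root_.sum_apply,
    ContinuousLinearMap.smulRight_apply, innerSL_apply_apply, inner_smul_left, conj_trivial,
    ContinuousLinearMap.id_apply, Finset.sum_add_distrib, mul_smul, ← Finset.smul_sum, one_pow,
    id_eq]
  module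

end Point

theorem contDiff_coneEquation : ContDiff ℝ ∞ (coneEquation A s) := by
  refine contDiff_const.smul (((contDiff_quadForm _).smul contDiff_id).sub ?_)
  simp only [momentOperator_apply]
  exact ContDiff.sum fun α _ => (contDiff_quadForm _).smul (A α).contDiff

theorem unitSquareSumSet_eq_levelSet (hA : IsCliffordFamily A) :
    unitSquareSumSet A s = levelSet {y | coneEquation A s y = 0} (quadForm (.id ℝ V)) 1 := by
  ext y
  simp only [levelSet, mem_ofPred_eq, hA.mem_unitSquareSumSet_iff, coneEquation]
  rw [and_comm, quadForm_id, pow_eq_one_iff_of_nonneg (norm_nonneg y) two_ne_zero,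
    and_congr_left_iff]
  intro h
  rw [h, one_pow, one_smul, smul_eq_zero_iff_right (by norm_num), sub_eq_zero, eq_comm]

/-- The cone equation takes its values in the range of a continuous family of operators. -/
theorem coneEquation_fixed (hA : IsCliffordFamily A) (y : V) :
    normalProjection A s y (coneEquation A s y) =
      ((quadForm (.id ℝ V) y - 1) / 2) • coneEquation A s y + coneEquation A s y +
        (inner ℝ (coneEquation A s y) (coneEquation A s y) +
          ((1 - quadForm (.id ℝ V) y) / 2) * inner ℝ y (coneEquation A s y)) • y := by
  set ρ := quadForm (.id ℝ V) y with hρ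
  set K := ∑ α ∈ s, quadForm (A α) y ^ 2
  set Z := momentOperator A s y y with hZ
  have hyy : inner ℝ y y = ρ := rfl
  have hZy : inner ℝ Z y = K := inner_momentOperator_self y
  have hZZ : inner ℝ Z Z = K * ρ := by
    rw [hZ, hA.momentOperator_symm, hA.momentOperator_momentOperator, inner_smul_right, hyy]
  have hAZ : ∀ α ∈ s, inner ℝ (A α y) Z = quadForm (A α) y * ρ := by
    intro α hα
    rw [hZ, momentOperator_apply, inner_sum]
    simp only [inner_smul_right, hA.inner_map_map, ← real_inner_self_eq_norm_sq, hyy]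
    simp [hα]
  have hQZ : momentOperator A s y Z = K • y := hA.momentOperator_momentOperator y y
  have hG : coneEquation A s y = (1 / 2 : ℝ) • (ρ • y - Z) := rfl
  -- For every y, on the cone or not, the value of the equation is orthogonal to all A_α y. With
  -- Q_y² scalar, this reduces the identity to polynomial algebra in |y|² and ∑ ⟨A_α y, y⟩².
  have h1 : ∑ α ∈ s, inner ℝ (A α y) (coneEquation A s y) • A α y = 0 := by
    refine Finset.sum_eq_zero fun α hα => ?_
    have : inner ℝ (A α y) y = quadForm (A α) y := rfl
    rw [hG, inner_smul_right, inner_sub_right, inner_smul_right, hAZ α hα, this]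
    simp [mul_comm]
  have h2 : inner ℝ y (coneEquation A s y) = (ρ ^ 2 - K) / 2 := by
    rw [hG, inner_smul_right, inner_sub_right, inner_smul_right, real_inner_comm Z y, hZy, hyy]
    ring
  have h3 : inner ℝ (coneEquation A s y) (coneEquation A s y) = ρ * (ρ ^ 2 - K) / 4 := by
    rw [hG, inner_smul_left, inner_smul_right, inner_sub_left, inner_sub_right, inner_sub_right,
      inner_smul_left, inner_smul_right, inner_smul_left, inner_smul_right,
      real_inner_comm Z y, hZy, hyy, hZZ]
    simp only [conj_trivial]
    ring
  rw [normalProjection_apply, h1, h2, h3, hG, map_smul, map_sub, map_smul, hQZ, ← hZ]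
  module

theorem definesNear_cone (hA : IsCliffordFamily A) {x : V} (hx : x ∈ unitSquareSumSet A s) :
    DefinesNear {y | coneEquation A s y = 0}
      (fun y => (normalProjection A s x).toLinearMap.rangeRestrict (coneEquation A s y)) x := by
  have hx0 : coneEquation A s x = 0 := (hA.unitSquareSumSet_eq_levelSet.le hx).1
  have hx1 := (mem_unitSquareSumSet.1 hx).1
  -- The error terms of `coneEquation_fixed` are absorbed into the operator, so that `B y` fixes the
  -- value of the equation at y. They vanish at y = x, where the norm is 1 and the equation holds.
  let B : V → V →L[ℝ] V := fun y => normalProjection A s y -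
    (((quadForm (.id ℝ V) y - 1) / 2) • ContinuousLinearMap.id ℝ V +
      (rankOne ℝ y (coneEquation A s y) + ((1 - quadForm (.id ℝ V) y) / 2) • rankOne ℝ y y))
  refine definesNear_of_projection (B := B) isOpen_univ (mem_univ x)
    contDiff_coneEquation.contDiffOn (by ext; simp) ?_ ?_ (fun y _ => ?_)
    (hA.hasFDerivAt_coneEquation hx) (by ext v; exact hA.normalProjection_idem hx v)
  · refine Continuous.continuousAt (continuous_clm_apply.2 fun v => ?_)
    have hq : ∀ P : V →L[ℝ] V, Continuous (quadForm P) := fun P => (contDiff_quadForm P).continuous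
    have hG : Continuous (coneEquation A s) := contDiff_coneEquation.continuous
    simp only [B, sub_apply, add_apply, smul_apply, normalProjection_apply, momentOperator_apply,
      ContinuousLinearMap.id_apply, rankOne_apply]
    fun_prop
  · simp [B, hx0, quadForm_id, hx1]
  · simp only [B, sub_apply, add_apply, smul_apply, ContinuousLinearMap.id_apply, rankOne_apply,
      hA.coneEquation_fixed]
    module

theorem ker_fderiv_cone (hA : IsCliffordFamily A) {x : V} (hx : x ∈ unitSquareSumSet A s) :
    (fderiv ℝ (fun y => (normalProjection A s x).toLinearMap.rangeRestrict (coneEquation A s y))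
      x).ker = (normalProjection A s x).ker :=
  fderiv_rangeRestrict_comp (hA.hasFDerivAt_coneEquation hx)
    (by ext v; exact hA.normalProjection_idem hx v)

theorem isEmbeddedSubmanifold_unitSquareSumSet (hA : IsCliffordFamily A)
    (hl : Module.finrank ℝ V = 2 * l) (hs : s.Nontrivial) :
    IsEmbeddedSubmanifold (unitSquareSumSet A s) (l + s.card - 2) := by
  intro x hx
  have h1 := hA.unitSquareSumSet_eq_levelSet (s := s)
  have h2 := hA.finrank_range_normalProjection hx hl hs
  have h3 : 1 < s.card := Finset.one_lt_card_iff_nontrivial.2 hs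
  rw [h1]
  refine ((hA.definesNear_cone hx).levelSet (contDiff_quadForm _) 1 (v := x) ?_ ?_).exists_chart ?_
  · exact (hA.ker_fderiv_cone hx).ge (hA.normalProjection_base hx)
  · rw [fderiv_quadForm (fun _ _ => rfl)]
    simp [(mem_unitSquareSumSet.1 hx).1]
  · rw [Module.finrank_prod, Module.finrank_self]
    omega

end IsCliffordFamily

end UnitSquareSum

/-! ### Tangent spaces, focal pairs and minimality for N_i -/

section UnitSquareSumGeometry

variable {V : Type*} [NormedAddCommGroup V] [InnerProductSpace ℝ V] [FiniteDimensional ℝ V]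
variable {ι : Type*} [DecidableEq ι]

namespace IsCliffordFamily

variable {A : ι → V →L[ℝ] V} {s : Finset ι} {l : ℕ}

theorem mem_tangentSubspace_unitSquareSumSet (hA : IsCliffordFamily A) {x : V}
    (hx : x ∈ unitSquareSumSet A s) {v : V} :
    v ∈ tangentSubspace (unitSquareSumSet A s) x ↔
      inner ℝ x v = 0 ∧ normalProjection A s x v = 0 := by
  have hx1 := (mem_unitSquareSumSet.1 hx).1
  have h1 := hA.unitSquareSumSet_eq_levelSet (s := s)
  have hx' := h1.le hx
  rw [h1, (hA.definesNear_cone hx).tangentSubspace_levelSet (contDiff_quadForm _) (v := x)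
    ((hA.ker_fderiv_cone hx).ge (hA.normalProjection_base hx))
    (by rw [fderiv_quadForm (fun _ _ => rfl)]; simp [hx1]) hx',
    (hA.definesNear_cone hx).tangentSubspace_eq hx'.1, hA.ker_fderiv_cone hx, Submodule.mem_inf,
    LinearMap.mem_ker, LinearMap.mem_ker, ContinuousLinearMap.coe_coe, ContinuousLinearMap.coe_coe,
    fderiv_quadForm (fun _ _ => rfl), and_comm]
  simp

theorem starProjection_unitSquareSumSet (hA : IsCliffordFamily A) {x : V}
    (hx : x ∈ unitSquareSumSet A s) (w : V) :
    (tangentSubspace (unitSquareSumSet A s) x).starProjection w =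
      w - normalProjection A s x w - inner ℝ x w • x := by
  have hx1 := (mem_unitSquareSumSet.1 hx).1
  refine starProjection_eq_of_mem
    ((hA.mem_tangentSubspace_unitSquareSumSet hx).2 ⟨?_, ?_⟩) fun v hv => ?_
  · rw [inner_sub_right, inner_sub_right, inner_smul_right, ← hA.normalProjection_symm,
      hA.normalProjection_base hx, real_inner_self_eq_norm_sq, hx1, inner_zero_left]
    ring
  · rw [map_sub, map_sub, hA.normalProjection_idem hx, map_smul, hA.normalProjection_base hx]
    simp
  · obtain ⟨h1, h2⟩ := (hA.mem_tangentSubspace_unitSquareSumSet hx).1 hv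
    rw [show w - (w - normalProjection A s x w - inner ℝ x w • x) =
      normalProjection A s x w + inner ℝ x w • x by abel, inner_add_right,
      ← hA.normalProjection_symm, h2, inner_zero_left, inner_smul_right, real_inner_comm x v, h1]
    ring

theorem isFocalTangent_unitSquareSumSet (hA : IsCliffordFamily A) {β : ι} (hβ : β ∈ s) {x : V}
    (hx : x ∈ unitSquareSumSet A s) :
    IsFocalTangent (A β) (tangentSubspace (unitSquareSumSet A s) x) x where
  unit := (mem_unitSquareSumSet.1 hx).1
  perp v hv := ((hA.mem_tangentSubspace_unitSquareSumSet hx).1 hv).1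
  grad := by
    refine (hA.mem_tangentSubspace_unitSquareSumSet hx).2 ⟨?_, ?_⟩
    · rw [inner_sub_right, inner_smul_right, real_inner_self_eq_norm_sq,
        (mem_unitSquareSumSet.1 hx).1, real_inner_comm, quadForm]
      ring
    · rw [map_sub, map_smul, hA.normalProjection_base hx, hA.normalProjection_map_base hx hβ]
      simp
  normal w hw w' hw' hxw hxw' := by
    have key : ∀ w ∈ (tangentSubspace (unitSquareSumSet A s) x)ᗮ, inner ℝ x w = 0 →
        momentOperator A s x w = -w := by
      intro w hw hxw
      have h1 := (Submodule.starProjection_apply_eq_zero_iff _).2 hw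
      rw [hA.starProjection_unitSquareSumSet hx, hxw, zero_smul, sub_zero, sub_eq_zero] at h1
      have h2 : ∀ v, inner ℝ (momentOperator A s x w) v = inner ℝ (-w) v := by
        intro v
        rw [hA.momentOperator_symm, h1, hA.normalProjection_symm,
          hA.normalProjection_momentOperator hx, inner_neg_right, ← hA.normalProjection_symm,
          inner_neg_left]
      exact ext_inner_right ℝ h2
    -- Moving Q_x across ⟨A_β w, w'⟩, with Q_x = −1 on both normal vectors and the anticommutator
    -- 2⟨A_β x, x⟩, gives the scalar condition.
    have h1 := hA.momentOperator_symm (s := s) x (A β w) w'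
    rw [hA.momentOperator_anticomm hβ, key w hw hxw, key w' hw' hxw', map_neg, neg_neg,
      inner_add_left, inner_smul_left, inner_neg_right] at h1
    simp only [conj_trivial] at h1
    linarith

theorem isClosed_unitSquareSumSet : IsClosed (unitSquareSumSet A s) := by
  have h1 : unitSquareSumSet A s =
      Metric.sphere 0 1 ∩ {x | ∑ α ∈ s, quadForm (A α) x ^ 2 = 1} := rfl
  rw [h1]
  exact Metric.isClosed_sphere.inter (isClosed_eq (continuous_finsetSum _ fun α _ =>
    (contDiff_quadForm _).continuous.pow 2) continuous_const)

theorem sum_sq_eq_sq_of_mem (f : ι → ℝ) {β : ι} (hβ : β ∈ s) :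
    ∑ α ∈ s, f α ^ 2 = f β ^ 2 + ∑ α ∈ s.erase β, f α ^ 2 :=
  (Finset.add_sum_erase s _ hβ).symm

theorem mem_unitSquareSumSet_of_eigenvector (hA : IsCliffordFamily A) {β : ι} (hβ : β ∈ s) {x : V}
    (hx : ‖x‖ = 1) (h : A β x = x ∨ A β x = -x) : x ∈ unitSquareSumSet A s := by
  refine mem_unitSquareSumSet.2 ⟨hx, ?_⟩
  rw [Finset.sum_eq_single_of_mem β hβ]
  · rcases h with h | h <;> simp [quadForm, h, hx]
  · intro α _ hne
    rw [hA.quadForm_eq_zero hne h]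
    norm_num

/-- The rank of the normal projection at a point of N_i is l + 1 − |s|, and a point exists among the
unit eigenvectors. This later supplies l ≥ 2 in part (2). -/
theorem card_le_of_nontrivial (hA : IsCliffordFamily A) (hl : Module.finrank ℝ V = 2 * l)
    (hl0 : 0 < l) (hs : s.Nontrivial) : s.card ≤ l + 1 := by
  obtain ⟨β, hβ⟩ := hs.nonempty
  obtain ⟨α, -, hα⟩ := hs.exists_ne β
  have h1 := (hA.isBalancedInvolution hα.symm).finrank_fixedSpace hl
  have := Module.nontrivial_of_finrank_pos (R := ℝ) (M := fixedSpace (A β)) (by omega)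
  obtain ⟨⟨w, hw⟩, hw1⟩ := exists_norm_eq (fixedSpace (A β)) zero_le_one
  have hx : w ∈ unitSquareSumSet A s :=
    hA.mem_unitSquareSumSet_of_eigenvector hβ hw1 (Or.inl hw)
  have h2 := hA.finrank_range_normalProjection hx hl hs
  omega

theorem isFocalPair_unitSquareSumSet (hA : IsCliffordFamily A) {β : ι} (hβ : β ∈ s)
    (hs : s.Nontrivial) (hl : Module.finrank ℝ V = 2 * l) :
    IsFocalPair (A β) (unitSquareSumSet A s) (l + s.card - 2) where
  involution := by
    obtain ⟨α, -, hα⟩ := hs.exists_ne β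
    exact hA.isBalancedInvolution hα.symm
  closed := isClosed_unitSquareSumSet
  subset_sphere _ hx := hx.1
  submanifold := hA.isEmbeddedSubmanifold_unitSquareSumSet hl hs
  tangent _ hx := hA.isFocalTangent_unitSquareSumSet hβ hx
  pos _ hx hPx := hA.mem_unitSquareSumSet_of_eigenvector hβ hx (Or.inl hPx)
  neg _ hx hPx := hA.mem_unitSquareSumSet_of_eigenvector hβ hx (Or.inr hPx)
  join u v hu hv huv a b hab := by
    obtain ⟨α₀, -, hα₀⟩ := hs.exists_ne β
    have huv0 : inner ℝ u v = 0 := (hA.isBalancedInvolution hα₀.symm).inner_eq_zero hu hv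
    have hnorm : ∀ a b : ℝ, ‖a • u + b • v‖ ^ 2 = a ^ 2 * ‖u‖ ^ 2 + b ^ 2 * ‖v‖ ^ 2 := by
      intro a b
      rw [norm_add_sq_real, norm_smul, norm_smul, inner_smul_left, inner_smul_right, huv0, mul_pow,
        mul_pow, Real.norm_eq_abs, Real.norm_eq_abs, sq_abs, sq_abs]
      ring
    have hq : ∀ a b : ℝ, ∑ α ∈ s, quadForm (A α) (a • u + b • v) ^ 2 =
        (a ^ 2 * ‖u‖ ^ 2 - b ^ 2 * ‖v‖ ^ 2) ^ 2 +
          a ^ 2 * b ^ 2 * ∑ α ∈ s.erase β, (2 * inner ℝ (A α u) v) ^ 2 := by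
      intro a b
      rw [sum_sq_eq_sq_of_mem _ hβ, Finset.mul_sum]
      congr 1
      · rw [hA.quadForm_combination, quadForm, quadForm, hu, hv, huv0, inner_neg_left,
          real_inner_self_eq_norm_sq, real_inner_self_eq_norm_sq]
        ring
      · refine Finset.sum_congr rfl fun α hα => ?_
        have hne := Finset.ne_of_mem_erase hα
        rw [hA.quadForm_combination, hA.quadForm_eq_zero hne (Or.inl hu),
          hA.quadForm_eq_zero hne (Or.inr hv)]
        ring
    obtain ⟨h1, h2⟩ := mem_unitSquareSumSet.1 huv
    have h3 := hq 1 1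
    have h4 := hnorm 1 1
    rw [one_smul, one_smul] at h3 h4
    rw [h2] at h3
    rw [h1] at h4
    have h5 := hnorm a b
    rw [hab] at h5
    refine mem_unitSquareSumSet.2 ⟨hab, ?_⟩
    rw [hq]
    -- The value is forced by the case a = b = 1, where |u|² + |v|² = 1. With it, the sum of squares
    -- for general a, b becomes (a²|u|² + b²|v|²)² = 1.
    have h6 : ∑ α ∈ s.erase β, (2 * inner ℝ (A α u) v) ^ 2 = 4 * ‖u‖ ^ 2 * ‖v‖ ^ 2 := by
      have h7 : (1 : ℝ) = (‖u‖ ^ 2 + ‖v‖ ^ 2) ^ 2 := by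
        rw [show ‖u‖ ^ 2 + ‖v‖ ^ 2 = 1 by linarith]; norm_num
      linarith
    rw [h6]
    have h8 : (1 : ℝ) = (a ^ 2 * ‖u‖ ^ 2 + b ^ 2 * ‖v‖ ^ 2) ^ 2 := by rw [← h5]; norm_num
    rw [h8]
    ring
  opposite v hv hPv := by
    obtain ⟨γ, hγ, hne⟩ := hs.exists_ne β
    have hb := hA.isBalancedInvolution hne
    -- Any other A_γ from the family carries the (−1)-eigenvector v to a fixed vector of A_β. For
    -- the 3–4–5 combination, the β-form is −7/25, the γ-form is 24/25 and the others vanish.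
    have hu1 : ‖A γ v‖ = 1 := by rw [hb.norm_map, hv]
    have hPu : A β (A γ v) = A γ v := by rw [hA.anti β γ hne.symm, hPv, map_neg, neg_neg]
    have huv0 : inner ℝ (A γ v) v = 0 :=
      (hA.isBalancedInvolution hne.symm).inner_eq_zero hPu hPv
    refine ⟨A γ v, hu1, hPu, mem_unitSquareSumSet.2
      ⟨norm_three_four_combination hu1 hv huv0, ?_⟩⟩
    rw [sum_sq_eq_sq_of_mem _ hβ,
      Finset.sum_eq_single_of_mem γ (Finset.mem_erase.2 ⟨hne, hγ⟩)]
    · rw [hA.quadForm_combination, hA.quadForm_combination γ,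
        hA.quadForm_eq_zero hne (Or.inl hPu), hA.quadForm_eq_zero hne (Or.inr hPv), quadForm,
        quadForm, hPu, hPv, huv0, inner_neg_left, hA.sq, real_inner_self_eq_norm_sq,
        real_inner_self_eq_norm_sq, hu1, hv]
      norm_num
    · intro α hα hne'
      have hαβ := Finset.ne_of_mem_erase hα
      rw [hA.quadForm_combination, hA.quadForm_eq_zero hαβ (Or.inl hPu),
        hA.quadForm_eq_zero hαβ (Or.inr hPv), hA.inner_comp_self_of_ne hne']
      norm_num

/-- The point x = Q_x x is a combination of the A_α x with α ∈ s, all orthogonal to A_β x. -/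
theorem quadForm_eq_zero_of_mem (hA : IsCliffordFamily A) {x : V} (hx : x ∈ unitSquareSumSet A s)
    {β : ι} (hβ : β ∉ s) : quadForm (A β) x = 0 := by
  have h1 : inner ℝ (A β x) (momentOperator A s x x) = 0 := by
    rw [momentOperator_apply, inner_sum]
    refine Finset.sum_eq_zero fun α hα => ?_
    rw [inner_smul_right, hA.inner_map_map_of_ne (ne_of_mem_of_not_mem hα hβ).symm, mul_zero]
  rwa [hA.momentOperator_self hx] at h1

theorem unitSquareSumSet_mono (hA : IsCliffordFamily A) {t : Finset ι} (hst : s ⊆ t) :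
    unitSquareSumSet A s ⊆ unitSquareSumSet A t := by
  intro x hx
  obtain ⟨hx1, hx2⟩ := mem_unitSquareSumSet.1 hx
  refine mem_unitSquareSumSet.2 ⟨hx1, ?_⟩
  rw [← Finset.sum_subset hst, hx2]
  intro β _ hβ
  rw [hA.quadForm_eq_zero_of_mem hx hβ]
  norm_num

theorem levelSet_unitSquareSumSet {β : ι} (hβ : β ∉ s) :
    levelSet (unitSquareSumSet A (insert β s)) (quadForm (A β)) 0 = unitSquareSumSet A s ∩
      {x | quadForm (A β) x = 0} := by
  ext x
  simp only [levelSet, mem_ofPred_eq, mem_unitSquareSumSet, mem_inter_iff, Finset.sum_insert hβ]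
  constructor
  · rintro ⟨⟨h1, h2⟩, h3⟩
    rw [h3] at h2
    exact ⟨⟨h1, by linarith⟩, h3⟩
  · rintro ⟨⟨h1, h2⟩, h3⟩
    rw [h2, h3]
    exact ⟨⟨h1, by norm_num⟩, rfl⟩

theorem levelSet_unitSquareSumSet_insert (hA : IsCliffordFamily A) {β : ι} (hβ : β ∉ s) :
    levelSet (unitSquareSumSet A (insert β s)) (quadForm (A β)) 0 = unitSquareSumSet A s := by
  rw [levelSet_unitSquareSumSet hβ, inter_eq_left]
  exact fun x hx => hA.quadForm_eq_zero_of_mem hx hβ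

/-- At a point of N_s the operators Q_x for s and t coincide, so the two tangent projections differ
only by the directions A_β x, β ∈ t \ s. Each component of the second fundamental form is then a sum
of rank-one quadratic forms, whose traces over T are computed one by one. -/
theorem isMinimalSubmanifold_unitSquareSumSet (hA : IsCliffordFamily A) {t : Finset ι}
    (hst : s ⊆ t) (hs : s.Nontrivial) (hl : Module.finrank ℝ V = 2 * l) :
    IsMinimalSubmanifold (unitSquareSumSet A s) (unitSquareSumSet A t) where
  ambient := ⟨_, hA.isEmbeddedSubmanifold_unitSquareSumSet hl (hs.mono hst)⟩
  submanifold := ⟨_, hA.isEmbeddedSubmanifold_unitSquareSumSet hl hs⟩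
  subset := hA.unitSquareSumSet_mono hst
  meanCurvature x hx := by
    have hx1 := (mem_unitSquareSumSet.1 hx).1
    have hxt := hA.unitSquareSumSet_mono hst hx
    set T := tangentSubspace (unitSquareSumSet A s) x with hT
    have hQ : ∀ v, momentOperator A t x v = momentOperator A s x v := by
      intro v
      rw [momentOperator_apply, momentOperator_apply]
      refine (Finset.sum_subset hst fun β _ hβ => ?_).symm
      rw [hA.quadForm_eq_zero_of_mem hx hβ, zero_smul]
    have hdiff : ∀ w, (tangentSubspace (unitSquareSumSet A t) x).starProjection w -
        T.starProjection w = ∑ β ∈ t \ s, inner ℝ (A β x) w • A β x := by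
      intro w
      rw [hT, hA.starProjection_unitSquareSumSet hxt, hA.starProjection_unitSquareSumSet hx,
        normalProjection_apply, normalProjection_apply, hQ, ← Finset.sum_sdiff hst]
      abel
    have hB : ∀ Y ∈ T, secondFundamentalForm (unitSquareSumSet A s) (unitSquareSumSet A t) x Y Y =
        ∑ β ∈ t \ s, (2 * ∑ α ∈ s, inner ℝ (rankOne ℝ (A α (A β x)) (A α x) Y) Y) • A β x := by
      intro Y hY
      have hY1 : inner ℝ x Y = 0 := ((hA.mem_tangentSubspace_unitSquareSumSet hx).1 hY).1
      have hlin : ∀ L : V →L[ℝ] V, HasFDerivAt (fun y => inner ℝ (L y) Y) (innerSL ℝ Y ∘L L) x :=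
        fun L => ((innerSL ℝ Y ∘L L).hasFDerivAt (x := x)).congr_of_eventuallyEq
          (Eventually.of_forall fun y => real_inner_comm Y (L y))
      have hN := (((((hA.hasFDerivAt_momentOperator_apply (s := s) x Y).const_sub Y).const_smul
        (1 / 2 : ℝ)).sub (HasFDerivAt.fun_sum fun α (_ : α ∈ s) => (hlin (A α)).smul
        (A α).hasFDerivAt)).add ((hlin (.id ℝ V)).smul (hasFDerivAt_id x)))
      have hD := (hN.const_sub Y).sub ((hlin (.id ℝ V)).smul (hasFDerivAt_id x))
      rw [secondFundamentalForm_eq hx hY hD fun y hy => by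
        rw [hA.starProjection_unitSquareSumSet hy Y, normalProjection_apply]; rfl, hdiff]
      refine Finset.sum_congr rfl fun β hβ => ?_
      obtain ⟨hβt, hβs⟩ := Finset.mem_sdiff.1 hβ
      congr 1
      have hβx : inner ℝ (A β x) x = 0 := hA.quadForm_eq_zero_of_mem hx hβs
      have hβα : ∀ α ∈ s, inner ℝ (A β x) (A α x) = 0 := fun α hα =>
        hA.inner_map_map_of_ne (ne_of_mem_of_not_mem hα hβs).symm x
      simp only [sub_apply, neg_apply, add_apply, smul_apply, _root_.sum_apply,
        ContinuousLinearMap.smulRight_apply, innerSL_apply_apply, ContinuousLinearMap.comp_apply,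
        ContinuousLinearMap.id_apply, rankOne_apply, inner_add_right, inner_sub_right,
        inner_neg_right, inner_smul_right, inner_sum, inner_smul_left, hY1, conj_trivial]
      have e1 : ∑ α ∈ s, (inner ℝ (A α x) Y * inner ℝ (A β x) (A α Y) +
          inner ℝ Y (A α Y) * inner ℝ (A β x) (A α x)) =
          ∑ α ∈ s, inner ℝ (A α x) Y * inner ℝ (A α (A β x)) Y :=
        Finset.sum_congr rfl fun α hα => by rw [hβα α hα, hA.symm α (A β x), mul_zero, add_zero]
      have e2 : ∑ α ∈ s, 2 * inner ℝ (A α x) Y * inner ℝ (A β x) (A α Y) =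
          2 * ∑ α ∈ s, inner ℝ (A α x) Y * inner ℝ (A α (A β x)) Y := by
        rw [Finset.mul_sum]
        exact Finset.sum_congr rfl fun α _ => by rw [hA.symm α (A β x), mul_assoc]
      rw [e1, e2, id_eq, hβx]
      ring
    rw [meanCurvatureVector, Finset.sum_congr rfl fun a _ => hB _ (Subtype.coe_prop _),
      Finset.sum_comm]
    refine Finset.sum_eq_zero fun β hβ => ?_
    obtain ⟨hβt, hβs⟩ := Finset.mem_sdiff.1 hβ
    have hβx : inner ℝ x (A β x) = 0 := by
      rw [real_inner_comm]; exact hA.quadForm_eq_zero_of_mem hx hβs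
    rw [← Finset.sum_smul, ← Finset.mul_sum, Finset.sum_comm, Finset.sum_eq_zero, mul_zero,
      zero_smul]
    intro α hα
    -- The tangent part of A_α x is A_α x − ⟨x, A_α x⟩x, and both summands are orthogonal to A_α A_β
    -- x.
    rw [sum_inner_orthonormalBasis, trace_rankOne_comp_starProjection,
      hA.starProjection_unitSquareSumSet hx, hA.normalProjection_map_base hx hα, sub_zero,
      inner_sub_left, inner_smul_left, hA.inner_map_map_self, hβx, ← hA.symm α x (A β x),
      hA.inner_map_map_of_ne (ne_of_mem_of_not_mem hα hβs)]
    simp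

end IsCliffordFamily

end UnitSquareSumGeometry

/-! ### From matrices to operators and index sets -/

section Matrices

variable {l m : ℕ}

/-- The operators on `ℝ^{2l}` defined by matrices. -/
def matrixOperator (P : Fin (m + 1) → Matrix (Fin (2 * l)) (Fin (2 * l)) ℝ) (α : Fin (m + 1)) :
    EuclideanSpace ℝ (Fin (2 * l)) →L[ℝ] EuclideanSpace ℝ (Fin (2 * l)) :=
  LinearMap.toContinuousLinearMap (P α).toEuclideanLin

theorem matrixOperator_matrixOperator (P : Fin (m + 1) → Matrix (Fin (2 * l)) (Fin (2 * l)) ℝ)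
    (α β : Fin (m + 1)) (x : EuclideanSpace ℝ (Fin (2 * l))) :
    matrixOperator P α (matrixOperator P β x) = (P α * P β).toEuclideanLin x := by
  simp [matrixOperator, Matrix.toLpLin_apply, Matrix.mulVec_mulVec]

theorem isCliffordFamily_matrixOperator {P : Fin (m + 1) → Matrix (Fin (2 * l)) (Fin (2 * l)) ℝ}
    (hP : IsSymmetricCliffordSystem P) : IsCliffordFamily (matrixOperator P) where
  symm α x y := by
    have h1 : (P α).toEuclideanLin.IsSymmetric := by
      rw [Matrix.isSymmetric_toEuclideanLin_iff]
      exact (Matrix.conjTranspose_eq_transpose_of_trivial (P α)).trans (hP.1 α)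
    exact h1 x y
  sq α x := by
    have h1 := hP.2 α α
    rw [if_pos rfl, ← two_smul ℝ] at h1
    rw [matrixOperator_matrixOperator, smul_right_injective _ two_ne_zero h1]
    simp
  anti α β hαβ x := by
    have h1 := hP.2 α β
    rw [if_neg hαβ, zero_smul] at h1
    rw [matrixOperator_matrixOperator, matrixOperator_matrixOperator, eq_neg_of_add_eq_zero_left h1]
    simp

theorem cliffordForm_eq (P : Fin (m + 1) → Matrix (Fin (2 * l)) (Fin (2 * l)) ℝ)
    (α : Fin (m + 1)) : cliffordForm (P α) = quadForm (matrixOperator P α) := rfl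

/-- The indices up to `i`. -/
def initialIndices (m i : ℕ) : Finset (Fin (m + 1)) :=
  Finset.univ.filter fun α : Fin (m + 1) => (α : ℕ) ≤ i

theorem mem_initialIndices {i : ℕ} {α : Fin (m + 1)} : α ∈ initialIndices m i ↔ (α : ℕ) ≤ i := by
  simp [initialIndices]

theorem card_initialIndices {i : ℕ} (hi : i ≤ m) : (initialIndices m i).card = i + 1 := by
  have h1 : initialIndices m i = Finset.Iic (⟨i, by omega⟩ : Fin (m + 1)) := by
    ext α
    simp [mem_initialIndices, Fin.le_def]
  rw [h1, Fin.card_Iic]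

theorem initialIndices_mono {i j : ℕ} (h : i ≤ j) : initialIndices m i ⊆ initialIndices m j :=
  fun _ hα => mem_initialIndices.2 ((mem_initialIndices.1 hα).trans h)

theorem initialIndices_nonempty {i : ℕ} : (initialIndices m i).Nonempty :=
  ⟨0, mem_initialIndices.2 (by simp)⟩

theorem initialIndices_nontrivial {i : ℕ} (h1 : 1 ≤ i) (hi : i ≤ m) :
    (initialIndices m i).Nontrivial := by
  rw [← Finset.one_lt_card_iff_nontrivial, card_initialIndices hi]
  omega

theorem insert_initialIndices {i : ℕ} {β : Fin (m + 1)} (hβ : (β : ℕ) = i + 1) :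
    insert β (initialIndices m i) = initialIndices m (i + 1) := by
  ext α
  rw [Finset.mem_insert, mem_initialIndices, mem_initialIndices, Fin.ext_iff]
  omega

theorem cliffordM_eq (P : Fin (m + 1) → Matrix (Fin (2 * l)) (Fin (2 * l)) ℝ) (i : ℕ) :
    cliffordM P i = commonZeroSet (matrixOperator P) (initialIndices m i) := by
  ext x
  simp only [cliffordM, commonZeroSet, mem_initialIndices, cliffordForm_eq]

theorem cliffordN_eq (P : Fin (m + 1) → Matrix (Fin (2 * l)) (Fin (2 * l)) ℝ) (i : ℕ) :
    cliffordN P i = unitSquareSumSet (matrixOperator P) (initialIndices m i) := rfl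

end Matrices

end

theorem theorem1p1 {l m : ℕ} (hl : 0 < l)
    (P : Fin (m + 1) → Matrix (Fin (2 * l)) (Fin (2 * l)) ℝ)
    (hP : IsSymmetricCliffordSystem P) :
    -- Part (1): the sets `M_i` and the functions `f_i = ⟨P_{i+1} x, x⟩`
    ((∀ i : ℕ, i ≤ m → IsEmbeddedSubmanifold (cliffordM P i) (2 * l - i - 2)) ∧
      (∀ i : Fin m, (i : ℕ) + 2 ≤ l →
        cliffordForm (P i.succ) '' cliffordM P i = Set.Icc (-1) 1 ∧
        IsIsoparametricFunction (cliffordM P i) (cliffordForm (P i.succ)) ∧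
        (∀ x ∈ cliffordM P i,
          ‖submanifoldGradient (cliffordM P i) (cliffordForm (P i.succ)) x‖ ^ 2
              = 4 * (1 - cliffordForm (P i.succ) x ^ 2) ∧
          submanifoldLaplacian (cliffordM P i) (cliffordForm (P i.succ)) x
              = -4 * ((l : ℝ) - (i : ℕ) - 1) * cliffordForm (P i.succ) x) ∧
        (∀ c ∈ Set.Ioo (-1 : ℝ) 1,
          let U := levelSet (cliffordM P i) (cliffordForm (P i.succ)) c
          let ξ := levelUnitNormal (cliffordM P i) (cliffordForm (P i.succ))
          IsEmbeddedSubmanifold U (2 * l - i - 3) ∧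
          ∀ x ∈ U,
            (∀ κ : ℝ, (shapeOperator U ξ x).HasEigenvalue κ →
              κ = -√((1 - c) / (1 + c)) ∨ κ = 0 ∨ κ = √((1 + c) / (1 - c))) ∧
            principalMultiplicity U ξ x (-√((1 - c) / (1 + c))) = l - i - 2 ∧
            principalMultiplicity U ξ x 0 = i + 1 ∧
            principalMultiplicity U ξ x (√((1 + c) / (1 - c))) = l - i - 2) ∧
        (∀ c : ℝ, c = 1 ∨ c = -1 →
          let U := levelSet (cliffordM P i) (cliffordForm (P i.succ)) c
          IsEmbeddedSubmanifold U (l - 1) ∧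
          AreRiemannianIsometric U (Metric.sphere (0 : EuclideanSpace ℝ (Fin l)) 1) ∧
          IsTotallyGeodesicSubmanifold U (cliffordM P i)) ∧
        IsIsoparametricHypersurface (cliffordM P (i + 1)) (cliffordM P i) ∧
        IsMinimalSubmanifold (cliffordM P (i + 1)) (cliffordM P i)) ∧
      (∀ i j : ℕ, i + j ≤ m → IsMinimalSubmanifold (cliffordM P (i + j)) (cliffordM P i))) ∧
    -- Part (2): the sets `N_i` and the functions `g_i = ⟨P_i x, x⟩`
    ((∀ i : ℕ, 1 ≤ i → i ≤ m → IsEmbeddedSubmanifold (cliffordN P i) (l + i - 1)) ∧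
      (∀ i : Fin (m + 1), 2 ≤ (i : ℕ) →
        cliffordForm (P i) '' cliffordN P i = Set.Icc (-1) 1 ∧
        IsIsoparametricFunction (cliffordN P i) (cliffordForm (P i)) ∧
        (∀ x ∈ cliffordN P i,
          ‖submanifoldGradient (cliffordN P i) (cliffordForm (P i)) x‖ ^ 2
              = 4 * (1 - cliffordForm (P i) x ^ 2) ∧
          submanifoldLaplacian (cliffordN P i) (cliffordForm (P i)) x
              = -4 * (i : ℕ) * cliffordForm (P i) x) ∧
        (∀ c ∈ Set.Ioo (-1 : ℝ) 1,
          let U := levelSet (cliffordN P i) (cliffordForm (P i)) c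
          let η := levelUnitNormal (cliffordN P i) (cliffordForm (P i))
          IsEmbeddedSubmanifold U (l + i - 2) ∧
          ∀ x ∈ U,
            (∀ κ : ℝ, (shapeOperator U η x).HasEigenvalue κ →
              κ = -√((1 - c) / (1 + c)) ∨ κ = 0 ∨ κ = √((1 + c) / (1 - c))) ∧
            principalMultiplicity U η x (-√((1 - c) / (1 + c))) = i - 1 ∧
            principalMultiplicity U η x 0 = l - i ∧
            principalMultiplicity U η x (√((1 + c) / (1 - c))) = i - 1) ∧
        (∀ c : ℝ, c = 1 ∨ c = -1 →
          let U := levelSet (cliffordN P i) (cliffordForm (P i)) c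
          IsEmbeddedSubmanifold U (l - 1) ∧
          AreRiemannianIsometric U (Metric.sphere (0 : EuclideanSpace ℝ (Fin l)) 1) ∧
          IsTotallyGeodesicSubmanifold U (cliffordN P i)) ∧
        IsIsoparametricHypersurface (cliffordN P (i - 1)) (cliffordN P i) ∧
        IsMinimalSubmanifold (cliffordN P (i - 1)) (cliffordN P i)) ∧
      (∀ i j : ℕ, 1 ≤ i → i + j ≤ m →
        IsMinimalSubmanifold (cliffordN P i) (cliffordN P (i + j)))) := by
  have hA := isCliffordFamily_matrixOperator hP
  have hdim : Module.finrank ℝ (EuclideanSpace ℝ (Fin (2 * l))) = 2 * l := finrank_euclideanSpace_fin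
  have hminM : ∀ i j : ℕ, IsMinimalSubmanifold (cliffordM P (i + j)) (cliffordM P i) := by
    intro i j
    rw [cliffordM_eq, cliffordM_eq]
    exact hA.isMinimalSubmanifold_commonZeroSet (initialIndices_mono (Nat.le_add_right i j))
      initialIndices_nonempty
  have hminN : ∀ i j : ℕ, 1 ≤ i → i + j ≤ m →
      IsMinimalSubmanifold (cliffordN P i) (cliffordN P (i + j)) := by
    intro i j hi hij
    exact hA.isMinimalSubmanifold_unitSquareSumSet (initialIndices_mono (Nat.le_add_right i j))
      (initialIndices_nontrivial hi (by omega)) hdim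
  refine ⟨⟨fun i hi => ?_, fun i hil => ?_, fun i j _ => hminM i j⟩,
    fun i h1 hi => ?_, fun i hi => ?_, hminN⟩
  · have h1 := hA.isEmbeddedSubmanifold_commonZeroSet (s := initialIndices m i)
    rw [card_initialIndices hi, hdim] at h1
    rw [cliffordM_eq]
    exact h1
  · have him : (i : ℕ) ≤ m := i.2.le
    have hβ : i.succ ∉ initialIndices m i := by
      rw [mem_initialIndices, Fin.val_succ]
      omega
    have hpair := hA.isFocalPair_commonZeroSet hβ initialIndices_nonempty hdim
      (by rw [card_initialIndices him]; omega)
    -- This identifies M_{i+1} with the level 0 of f_i, where the gradient has norm 2.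
    have hlevel := IsCliffordFamily.levelSet_commonZeroSet (A := matrixOperator P) (s := initialIndices m i)
      (β := i.succ)
    rw [insert_initialIndices (Fin.val_succ i), ← cliffordM_eq, ← cliffordM_eq] at hlevel
    rw [card_initialIndices him, ← cliffordM_eq] at hpair
    have hl2 : 2 ≤ l := by omega
    have hcast : ((2 * l - ((i : ℕ) + 1) - 1 : ℕ) : ℝ) = 2 * l - (i : ℕ) - 2 := by
      rw [Nat.sub_sub, Nat.cast_sub (by omega)]
      push_cast
      ring
    simp only [cliffordForm_eq]
    refine ⟨hpair.image_quadForm hdim hl2, hpair.isIsoparametricFunction hdim hl2,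
      fun x hx => ⟨hpair.norm_submanifoldGradient_sq hx, ?_⟩, fun c hc => ⟨?_, fun x hx => ?_⟩,
      fun c hc => hpair.focal hdim hl hc, ?_, hminM i 1⟩
    · rw [hpair.submanifoldLaplacian_eq hdim hx, hcast]
      ring
    · have h1 := hpair.isEmbeddedSubmanifold_levelSet (by omega) hc
      rwa [show 2 * l - ((i : ℕ) + 1) - 1 - 1 = 2 * l - i - 3 by omega] at h1
    · have h1 := hpair.principalCurvatures hdim hc hx
      rwa [show 2 * l - ((i : ℕ) + 1) - 1 - l = l - i - 2 by omega,
        show 2 * l - (2 * l - ((i : ℕ) + 1) - 1) - 1 = i + 1 by omega] at h1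
    · rw [← hlevel]
      exact hpair.isIsoparametricHypersurface hdim hl2
  · have h2 := hA.isEmbeddedSubmanifold_unitSquareSumSet hdim (initialIndices_nontrivial h1 hi)
    rwa [card_initialIndices hi, show l + (i + 1) - 2 = l + i - 1 by omega] at h2
  · have him : (i : ℕ) ≤ m := Nat.lt_succ_iff.1 i.2
    have hnt := initialIndices_nontrivial (m := m) (i := i) (by omega) him
    have hβ : i ∈ initialIndices m i := mem_initialIndices.2 le_rfl
    have hpair := hA.isFocalPair_unitSquareSumSet hβ hnt hdim
    rw [card_initialIndices him, ← cliffordN_eq,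
      show l + ((i : ℕ) + 1) - 2 = l + i - 1 by omega] at hpair
    obtain ⟨k, hk⟩ : ∃ k : ℕ, (i : ℕ) = k + 1 := ⟨i - 1, by omega⟩
    have hlevel := hA.levelSet_unitSquareSumSet_insert (s := initialIndices m k) (β := i)
      (by rw [mem_initialIndices]; omega)
    rw [insert_initialIndices hk, ← hk, ← cliffordN_eq, ← cliffordN_eq] at hlevel
    -- Here l ≥ 2 is not assumed: i ≥ 2 gives at least three anticommuting involutions, and the rank
    -- bound i + 1 ≤ l + 1 yields it.
    have hl2 : 2 ≤ l := by
      have h1 := hA.card_le_of_nontrivial hdim hl hnt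
      rw [card_initialIndices him] at h1
      omega
    have hcast : ((l + (i : ℕ) - 1 : ℕ) : ℝ) = l + (i : ℕ) - 1 := by
      rw [Nat.cast_sub (by omega)]
      push_cast
      ring
    have hk' : (i : ℕ) - 1 = k := by omega
    have hmin := hminN k 1 (by omega) (by omega)
    rw [← hk] at hmin
    simp only [cliffordForm_eq]
    refine ⟨hpair.image_quadForm hdim hl2, hpair.isIsoparametricFunction hdim hl2,
      fun x hx => ⟨hpair.norm_submanifoldGradient_sq hx, ?_⟩, fun c hc => ⟨?_, fun x hx => ?_⟩,
      fun c hc => hpair.focal hdim hl hc, ?_, by rwa [hk']⟩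
    · rw [hpair.submanifoldLaplacian_eq hdim hx, hcast]
      ring
    · have h1 := hpair.isEmbeddedSubmanifold_levelSet (by omega) hc
      rwa [show l + (i : ℕ) - 1 - 1 = l + i - 2 by omega] at h1
    · have h1 := hpair.principalCurvatures hdim hc hx
      rwa [show l + (i : ℕ) - 1 - l = i - 1 by omega,
        show 2 * l - (l + (i : ℕ) - 1) - 1 = l - i by omega] at h1
    · rw [hk', ← hlevel]
      exact hpair.isIsoparametricHypersurface hdim hl2
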